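/- Let $R$ be a ring, let $X$ be a topological space and let $\mathcal U=(U_i)_{i\in I}$ be a family of subsets of $X$, where $I$ is a linearly ordered set, such that the interiors of the sets $U_i$ cover $X$. Let $N$ be the nerve of $\mathcal U$: its simplices are the finite non-empty sets $\sigma\subset I$ with $|\sigma|:=\bigcap_{i\in\sigma}U_i\neq\varnothing$. Let $N_p$ be the set of $p$-dimensional simplices, and let $C_\bullet(N)$ be the complex of simplicial chains of $N$ with coefficients in $R$. For a simplex $\sigma=\{v_0<\dots<v_p\}$ put $\partial_i\sigma=\sigma\smallsetminus\{v_i\}$. Let $e_\bullet$ be a covariant functor from the category of subspaces $Z\subset X$ and inclusions to augmented chain complexes of $R$-modules $$0\longleftarrow R\overset{d_0}{\longleftarrow} e_0(Z)\overset{d_1}{\longleftarrow} e_1(Z)\longleftarrow\cdots ,$$ where morphisms of augmented complexes are chain maps which are the identity on the term $R$. Denote by $\widetilde H_*(Z)$ the homology of $e_\bullet(Z)$ with the term $R$ omitted. The family $\mathcal U$ is called $e_\bullet$-acyclic if the augmented complex $e_\bullet(|\sigma|)$ is exact for every simplex $\sigma$ of $N$. Let $C_\bullet$ be the functor of singular chains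 with coefficients in $R$, with the usual augmentation, and let $\varphi\colon C_\bullet\to e_\bullet$ be a natural transformation of functors to augmented chain complexes; it induces a homomorphism $\varphi_*\colon H_*(X)\to\widetilde H_*(X)$. For a functor $e_\bullet$ as above (for example, for $C_\bullet$) let $c_p(N,e_q)=\bigoplus_{\sigma\in N_p}e_q(|\sigma|)$ for $p,q\ge 0$. Let $d$ be the direct sum of the differentials of $e_\bullet(|\sigma|)$, and for $p\ge 1$ let $\delta\colon c_p(N,e_q)\to c_{p-1}(N,e_q)$ be equal on $e_q(|\sigma|)$ to $\sum_{i=0}^{p}(-1)^i\Delta_{\sigma,i}$, where $\Delta_{\sigma,i}\colon e_q(|\sigma|)\to e_q(|\partial_i\sigma|)$ is induced by the inclusion. Let $t_\bullet(N,e)$ be the total complex, $t_n(N,e)=\bigoplus_{p+q=n}c_p(N,e_q)$, with the differential $d+(-1)^q\delta$ on $c_p(N,e_q)$. Let $\lambda_e\colon t_\bullet(N,e)\to C_\bullet(N)$ be the morphism equal to the direct sum of the augmentations $e_0(|\sigma|)\to R$ on $c_p(N,e_0)$ and to $0$ on $c_p(N,e_q)$ with $q>0$. Let $\tau_e\colon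 t_\bullet(N,e)\to e_\bullet(X)$ (term $R$ omitted) be the morphism induced by the inclusions $|\sigma|\subset X$ on $c_0(N,e_q)$ and equal to $0$ on $c_p(N,e_q)$ with $p>0$. Suppose that $\mathcal U$ is $e_\bullet$-acyclic. Then $\tau_{C*}\colon H_n(t_\bullet(N,C))\to H_n(X)$ is an isomorphism for every $n\ge 0$, so that the canonical homomorphism $l_{\mathcal U}=\lambda_{C*}\circ\tau_{C*}^{-1}\colon H_n(X)\to H_n(N)$ is defined, and for every $n\ge 0$ there exists an $R$-linear map $g\colon H_n(N)\to\widetilde H_n(X)$ such that $\varphi_*=g\circ l_{\mathcal U}$. -/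

import Mathlib

open CategoryTheory Limits

universe u

noncomputable section

namespace HomologicalLeray

/-! ### The nerve of a covering -/

/-- The nerve of a family `U` of subsets of `X`: its simplices are the finite non-empty sets of
indices such that the corresponding members of the family have non-empty intersection. -/
def nerve {X ι : Type u} (U : ι → Set X) : PreAbstractSimplicialComplex ι where
  faces := {σ | σ.Nonempty ∧ (⋂ i ∈ σ, U i).Nonempty}
  isRelLowerSet_faces := fun {_} hσ =>
    ⟨hσ.1, fun _ hτ hne => ⟨hne, hσ.2.mono (Set.biInter_subset_biInter_left hτ)⟩⟩

/-- `|σ|`, the intersection of the members of the family corresponding to the vertices of `σ`. -/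
def support {X ι : Type u} (U : ι → Set X) (σ : Finset ι) : Set X := ⋂ i ∈ σ, U i

lemma support_anti {X ι : Type u} (U : ι → Set X) {σ τ : Finset ι} (h : τ ⊆ σ) :
    support U σ ≤ support U τ :=
  Set.biInter_subset_biInter_left h

/-- The set `N_p` of `p`-dimensional simplices of the nerve. -/
abbrev Simplices {X ι : Type u} (U : ι → Set X) (p : ℕ) : Type u :=
  {σ : Finset ι // σ ∈ nerve U ∧ σ.card = p + 1}

/-- The face of `σ` opposite to its vertex `v`. -/
def Simplices.face {X ι : Type u} [LinearOrder ι] {U : ι → Set X} {p : ℕ}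
    (σ : Simplices U (p + 1)) (v : {v : ι // v ∈ σ.1}) : Simplices U p :=
  ⟨σ.1.erase v.1, by
    have hc : (σ.1.erase v.1).card = p + 1 := by
      rw [Finset.card_erase_of_mem v.2, σ.2.2]; rfl
    exact ⟨((nerve U).isRelLowerSet_faces σ.2.1).2 (Finset.erase_subset _ _)
      (Finset.card_pos.mp (by omega)), hc⟩⟩

/-- The inclusion `|σ| ⊆ |∂σ|`, where `∂σ` is the face of `σ` opposite to `v`, as a morphism. -/
def Simplices.faceIncl {X ι : Type u} [LinearOrder ι] {U : ι → Set X} {p : ℕ}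
    (σ : Simplices U (p + 1)) (v : {v : ι // v ∈ σ.1}) :
    support U σ.1 ⟶ support U (σ.face v).1 :=
  homOfLE (support_anti U (Finset.erase_subset v.1 σ.1))

/-- The position of `v` among the elements of `σ` listed in increasing order: if
`v₀ < v₁ < … < v_p` are the elements of `σ`, then the position of `v_i` is `i`. -/
def position {ι : Type u} [LinearOrder ι] (σ : Finset ι) (v : ι) : ℕ :=
  (σ.filter (fun w => w < v)).card

/-! ### Chains of the nerve with coefficients in a covariant functor on subspaces -/

section NerveChains

variable {R : Type u} [Ring R] {X : Type u} {ι : Type u} [LinearOrder ι] (U : ι → Set X)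

/-- `⨁_{σ ∈ N_p} F(|σ|)`. -/
def nerveChainsX (F : Set X ⥤ ModuleCat.{u} R) (p : ℕ) : ModuleCat.{u} R :=
  ModuleCat.of R (DirectSum (Simplices U p) (fun σ => F.obj (support U σ.1)))

/-- The inclusion of the summand `F(|σ|)`. -/
def nerveι (F : Set X ⥤ ModuleCat.{u} R) {p : ℕ} (σ : Simplices U p) :
    F.obj (support U σ.1) ⟶ nerveChainsX U F p :=
  ModuleCat.ofHom (DirectSum.lof R (Simplices U p) (fun τ => F.obj (support U τ.1)) σ)

/-- The morphism out of the direct sum with given restrictions to the summands. -/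
def nerveDesc {F : Set X ⥤ ModuleCat.{u} R} {p : ℕ} {A : ModuleCat.{u} R}
    (f : ∀ σ : Simplices U p, F.obj (support U σ.1) ⟶ A) : nerveChainsX U F p ⟶ A :=
  ModuleCat.ofHom (DirectSum.toModule R (Simplices U p) A (fun σ => (f σ).hom))

lemma nerveι_desc {F : Set X ⥤ ModuleCat.{u} R} {p : ℕ} {A : ModuleCat.{u} R}
    (f : ∀ σ : Simplices U p, F.obj (support U σ.1) ⟶ A) (σ : Simplices U p) :
    nerveι U F σ ≫ nerveDesc U f = f σ := by
  apply ModuleCat.hom_ext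
  apply LinearMap.ext
  intro x
  exact DirectSum.toModule_lof (M := fun τ : Simplices U p => F.obj (support U τ.1))
    (φ := fun τ => (f τ).hom) R σ x

lemma nerveChainsX_hom_ext {F : Set X ⥤ ModuleCat.{u} R} {p : ℕ} {A : ModuleCat.{u} R}
    {f g : nerveChainsX U F p ⟶ A} (h : ∀ σ, nerveι U F σ ≫ f = nerveι U F σ ≫ g) : f = g := by
  apply ModuleCat.hom_ext
  apply DirectSum.linearMap_ext
  intro σ
  exact congrArg ModuleCat.Hom.hom (h σ)

/-- The boundary map `δ_{p+1} : ⨁_{σ ∈ N_{p+1}} F(|σ|) → ⨁_{σ ∈ N_p} F(|σ|)`. On a summand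
`F(|σ|)` it is the sum, over the vertices `v_i` of `σ` listed in increasing order, of `(-1)^i`
times the map `F(|σ|) → F(|∂_i σ|)` induced by the inclusion `|σ| ⊆ |∂_i σ|`. -/
def nerveBoundary (F : Set X ⥤ ModuleCat.{u} R) (p : ℕ) :
    nerveChainsX U F (p + 1) ⟶ nerveChainsX U F p :=
  nerveDesc U (fun σ => ∑ v : {v : ι // v ∈ σ.1},
    ((-1 : ℤ) ^ position σ.1 v.1) • (F.map (σ.faceIncl v) ≫ nerveι U F (σ.face v)))

lemma nerveι_boundary (F : Set X ⥤ ModuleCat.{u} R) {p : ℕ} (σ : Simplices U (p + 1)) :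
    nerveι U F σ ≫ nerveBoundary U F p = ∑ v : {v : ι // v ∈ σ.1},
      ((-1 : ℤ) ^ position σ.1 v.1) • (F.map (σ.faceIncl v) ≫ nerveι U F (σ.face v)) :=
  nerveι_desc U _ σ

lemma position_erase {σ : Finset ι} {v w : ι} (hw : w ∈ σ) :
    position (σ.erase w) v = if w < v then position σ v - 1 else position σ v := by
  unfold position
  split_ifs with h
  · rw [← Finset.card_erase_of_mem (s := σ.filter (fun x => x < v)) (a := w) (by simp [hw, h])]
    congr 1
    ext x
    simp only [Finset.mem_filter, Finset.mem_erase]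
    tauto
  · congr 1
    ext x
    simp only [Finset.mem_filter, Finset.mem_erase]
    constructor
    · tauto
    · rintro ⟨hx, hxv⟩
      exact ⟨⟨fun e => h (e ▸ hxv), hx⟩, hxv⟩

lemma position_pos {σ : Finset ι} {v w : ι} (hw : w ∈ σ) (h : w < v) : 0 < position σ v :=
  Finset.card_pos.mpr ⟨w, by simp [hw, h]⟩

lemma sign_swap {σ : Finset ι} {v w : ι} (hv : v ∈ σ) (hw : w ∈ σ) (hvw : v ≠ w) :
    (-1 : ℤ) ^ position σ v * (-1) ^ position (σ.erase v) w =
      -((-1 : ℤ) ^ position σ w * (-1) ^ position (σ.erase w) v) := by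
  rw [position_erase hv, position_erase hw]
  rcases lt_or_gt_of_ne hvw with h | h
  · obtain ⟨k, hk⟩ := Nat.exists_eq_succ_of_ne_zero (position_pos hv h).ne'
    rw [if_pos h, if_neg h.asymm, hk]
    simp only [Nat.succ_eq_add_one, Nat.add_sub_cancel, pow_succ]
    ring
  · obtain ⟨k, hk⟩ := Nat.exists_eq_succ_of_ne_zero (position_pos hw h).ne'
    rw [if_neg h.asymm, if_pos h, hk]
    simp only [Nat.succ_eq_add_one, Nat.add_sub_cancel, pow_succ]
    ring

lemma map_nerveι_congr (F : Set X ⥤ ModuleCat.{u} R) {p : ℕ} {A : Set X}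
    {τ τ' : Simplices U p} (h : τ = τ') (f : A ⟶ support U τ.1) (f' : A ⟶ support U τ'.1) :
    F.map f ≫ nerveι U F τ = F.map f' ≫ nerveι U F τ' := by
  subst h
  rw [Subsingleton.elim f f']

lemma nerveBoundary_comp (F : Set X ⥤ ModuleCat.{u} R) (p : ℕ) :
    nerveBoundary U F (p + 1) ≫ nerveBoundary U F p = 0 := by
  apply nerveChainsX_hom_ext
  intro σ
  rw [reassoc_of% nerveι_boundary, comp_zero, Preadditive.sum_comp]
  simp only [Preadditive.zsmul_comp, Category.assoc, nerveι_boundary, Preadditive.comp_sum,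
    Preadditive.comp_zsmul, Finset.smul_sum, smul_smul, ← F.map_comp_assoc]
  have hmem : ∀ (v : {v : ι // v ∈ σ.1}) (w : {w : ι // w ∈ (σ.face v).1}),
      w.1 ∈ σ.1 ∧ w.1 ≠ v.1 := fun v w =>
    ⟨Finset.mem_of_mem_erase w.2, Finset.ne_of_mem_erase w.2⟩
  rw [Finset.sum_sigma']
  refine Finset.sum_involution
    (fun a _ => ⟨⟨a.2.1, (hmem a.1 a.2).1⟩,
      ⟨a.1.1, Finset.mem_erase.mpr ⟨(hmem a.1 a.2).2.symm, a.1.2⟩⟩⟩) ?_ ?_ ?_ ?_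
  · rintro ⟨v, w⟩ -
    have hs := sign_swap v.2 (hmem v w).1 (hmem v w).2.symm
    have hface : (σ.face v).face w =
        (σ.face ⟨w.1, (hmem v w).1⟩).face
          ⟨v.1, Finset.mem_erase.mpr ⟨(hmem v w).2.symm, v.2⟩⟩ :=
      Subtype.ext Finset.erase_right_comm
    dsimp only
    rw [map_nerveι_congr U F hface _
      (σ.faceIncl ⟨w.1, (hmem v w).1⟩ ≫ (σ.face ⟨w.1, (hmem v w).1⟩).faceIncl
          ⟨v.1, Finset.mem_erase.mpr ⟨(hmem v w).2.symm, v.2⟩⟩), ← add_smul]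
    have : (-1 : ℤ) ^ position σ.1 v.1 * (-1) ^ position (σ.face v).1 w.1 +
        (-1 : ℤ) ^ position σ.1 w.1 *
          (-1) ^ position (σ.face ⟨w.1, (hmem v w).1⟩).1 v.1 = 0 := by
      change (-1 : ℤ) ^ position σ.1 v.1 * (-1) ^ position (σ.1.erase v.1) w.1 +
        (-1 : ℤ) ^ position σ.1 w.1 * (-1) ^ position (σ.1.erase w.1) v.1 = 0
      rw [hs]; ring
    rw [this, zero_smul]
  · rintro ⟨v, w⟩ - _ h
    exact (hmem v w).2 (congrArg (fun a => a.1.1) h)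
  · intro a _
    exact Finset.mem_sigma.mpr ⟨Finset.mem_univ _, Finset.mem_univ _⟩
  · rintro ⟨v, w⟩ -
    rfl

/-- The chain complex `… → ⨁_{σ ∈ N_1} F(|σ|) → ⨁_{σ ∈ N_0} F(|σ|)`. -/
abbrev nerveChains (F : Set X ⥤ ModuleCat.{u} R) : ChainComplex (ModuleCat.{u} R) ℕ :=
  ChainComplex.of (nerveChainsX U F) (nerveBoundary U F) (nerveBoundary_comp U F)

lemma nerveChains_d (F : Set X ⥤ ModuleCat.{u} R) (p : ℕ) :
    (nerveChains U F).d (p + 1) p = nerveBoundary U F p :=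
  ChainComplex.of_d (nerveChainsX U F) (nerveBoundary U F) p

/-- The direct sum, over `σ ∈ N_p`, of the components `F(|σ|) → G(|σ|)` of `α`. -/
def nerveChainsMapX {F G : Set X ⥤ ModuleCat.{u} R} (α : F ⟶ G) (p : ℕ) :
    nerveChainsX U F p ⟶ nerveChainsX U G p :=
  nerveDesc U (fun σ => α.app (support U σ.1) ≫ nerveι U G σ)

lemma nerveι_mapX {F G : Set X ⥤ ModuleCat.{u} R} (α : F ⟶ G) {p : ℕ} (σ : Simplices U p) :
    nerveι U F σ ≫ nerveChainsMapX U α p = α.app (support U σ.1) ≫ nerveι U G σ :=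
  nerveι_desc U _ σ

lemma nerveChainsMapX_comm {F G : Set X ⥤ ModuleCat.{u} R} (α : F ⟶ G) (p : ℕ) :
    nerveChainsMapX U α (p + 1) ≫ nerveBoundary U G p =
      nerveBoundary U F p ≫ nerveChainsMapX U α p := by
  apply nerveChainsX_hom_ext
  intro σ
  rw [reassoc_of% nerveι_mapX, nerveι_boundary, reassoc_of% nerveι_boundary]
  simp only [Preadditive.sum_comp, Preadditive.comp_sum, Preadditive.zsmul_comp,
    Preadditive.comp_zsmul, Category.assoc, nerveι_mapX, NatTrans.naturality_assoc]

/-- The morphism of complexes induced by a natural transformation of coefficients. -/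
def nerveChainsMap {F G : Set X ⥤ ModuleCat.{u} R} (α : F ⟶ G) :
    nerveChains U F ⟶ nerveChains U G :=
  ChainComplex.ofHom (X := nerveChains U F) (Y := nerveChains U G) (nerveChainsMapX U α)
    (fun p => by rw [nerveChains_d, nerveChains_d]; exact nerveChainsMapX_comm U α p)

lemma nerveChainsMap_comp {F G H : Set X ⥤ ModuleCat.{u} R} (α : F ⟶ G) (β : G ⟶ H) :
    nerveChainsMap U α ≫ nerveChainsMap U β = nerveChainsMap U (α ≫ β) := by
  ext p : 1
  change nerveChainsMapX U α p ≫ nerveChainsMapX U β p = nerveChainsMapX U (α ≫ β) p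
  apply nerveChainsX_hom_ext
  intro σ
  rw [reassoc_of% nerveι_mapX, nerveι_mapX, nerveι_mapX, NatTrans.comp_app, Category.assoc]

lemma nerveChainsMap_zero (F G : Set X ⥤ ModuleCat.{u} R) :
    nerveChainsMap U (0 : F ⟶ G) = 0 := by
  ext p : 1
  change nerveChainsMapX U (0 : F ⟶ G) p = 0
  apply nerveChainsX_hom_ext
  intro σ
  rw [nerveι_mapX]
  simp

/-- The map `δ_0 : ⨁_{σ ∈ N_0} F(|σ|) → F(X)` induced by the inclusions `|σ| ⊆ X`. -/
def nerveAugmentation (F : Set X ⥤ ModuleCat.{u} R) :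
    nerveChainsX U F 0 ⟶ F.obj Set.univ :=
  nerveDesc U (fun σ : Simplices U 0 => F.map (homOfLE (Set.subset_univ (support U σ.1))))

lemma nerveι_augmentation (F : Set X ⥤ ModuleCat.{u} R) (σ : Simplices U 0) :
    nerveι U F σ ≫ nerveAugmentation U F =
      F.map (homOfLE (Set.subset_univ (support U σ.1))) :=
  nerveι_desc U _ σ

lemma nerveChainsMap_augmentation {F G : Set X ⥤ ModuleCat.{u} R} (α : F ⟶ G) :
    (nerveChainsMap U α).f 0 ≫ nerveAugmentation U G =
      nerveAugmentation U F ≫ α.app Set.univ := by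
  apply nerveChainsX_hom_ext
  intro σ
  change nerveι U F σ ≫ nerveChainsMapX U α 0 ≫ nerveAugmentation U G = _
  rw [reassoc_of% nerveι_mapX, nerveι_augmentation, reassoc_of% nerveι_augmentation, α.naturality]

lemma nerveChains_d_augmentation (F : Set X ⥤ ModuleCat.{u} R) :
    (nerveChains U F).d 1 0 ≫ nerveAugmentation U F = 0 := by
  rw [nerveChains_d]
  apply nerveChainsX_hom_ext
  intro σ
  have h0 : ∑ v : {v : ι // v ∈ σ.1}, (-1 : ℤ) ^ position σ.1 v.1 = 0 := by
    obtain ⟨a, b, hab, hσ⟩ := Finset.card_eq_two.mp σ.2.2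
    rw [Finset.sum_coe_sort σ.1 (fun v => (-1 : ℤ) ^ position σ.1 v), hσ,
      Finset.sum_pair hab]
    unfold position
    rcases lt_or_gt_of_ne hab with h | h
    · simp [Finset.filter_insert, Finset.filter_singleton, h, h.asymm]
    · simp [Finset.filter_insert, Finset.filter_singleton, h, h.asymm]
  rw [reassoc_of% nerveι_boundary, Preadditive.sum_comp, comp_zero]
  simp only [Preadditive.zsmul_comp, Category.assoc, nerveι_augmentation, ← F.map_comp]
  have : ∀ v : {v : ι // v ∈ σ.1}, σ.faceIncl v ≫ homOfLE (Set.subset_univ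
      (support U (σ.face v).1)) = homOfLE (Set.subset_univ (support U σ.1)) := fun _ => rfl
  simp only [this]
  rw [← Finset.sum_smul, h0, zero_smul]

end NerveChains

/-! ### Generalized chains -/

/-- A covariant functor `e_•` from the category of subspaces of `X` (with inclusions as
morphisms) to augmented chain complexes `R ← e_0(Z) ← e_1(Z) ← …` of `R`-modules. The inclusion
morphisms are morphisms of augmented complexes, i.e. are the identity on the term `R`. -/
structure AugmentedChainFunctor (R : Type u) [Ring R] (X : Type u) where
  /-- The complexes `e_0(Z) ← e_1(Z) ← …`, with the term `R` omitted. -/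
  chains : Set X ⥤ ChainComplex (ModuleCat.{u} R) ℕ
  /-- The augmentation `d_0 : e_0(Z) → R`. -/
  aug : chains ⋙ HomologicalComplex.eval _ _ 0 ⟶ (Functor.const (Set X)).obj (ModuleCat.of R R)
  d_aug : ∀ Z, (chains.obj Z).d 1 0 ≫ aug.app Z = 0

namespace AugmentedChainFunctor

variable {R : Type u} [Ring R] {X : Type u}

/-- The augmented complex `0 ← R ← e_0(Z) ← e_1(Z) ← …`. -/
def augmented (e : AugmentedChainFunctor R X) (Z : Set X) : ChainComplex (ModuleCat.{u} R) ℕ :=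
  (e.chains.obj Z).augment (e.aug.app Z) (e.d_aug Z)

/-- Natural transformations of functors to augmented chain complexes. -/
structure Hom (e e' : AugmentedChainFunctor R X) where
  toNatTrans : e.chains ⟶ e'.chains
  comp_aug : ∀ Z, (toNatTrans.app Z).f 0 ≫ e'.aug.app Z = e.aug.app Z

/-- The `e_•`-homology `H^e_n(Z)`: the homology of `e_•(Z)` with the term `R` omitted. -/
abbrev homology (e : AugmentedChainFunctor R X) (Z : Set X) (n : ℕ) : ModuleCat.{u} R :=
  (e.chains.obj Z).homology n

/-- The map in homology induced by a natural transformation. -/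
abbrev Hom.homologyMap {e e' : AugmentedChainFunctor R X} (φ : e.Hom e') (Z : Set X) (n : ℕ) :
    e.homology Z n ⟶ e'.homology Z n :=
  HomologicalComplex.homologyMap (φ.toNatTrans.app Z) n

/-- The covering `U` is `e_•`-acyclic: the augmented complex `e_•(|σ|)` is exact for every
simplex `σ` of the nerve. -/
def IsAcyclicCover (e : AugmentedChainFunctor R X) {ι : Type u} (U : ι → Set X) : Prop :=
  ∀ σ ∈ nerve U, (e.augmented (support U σ)).Acyclic

/-- The functor `Z ↦ e_q(Z)`. -/
def component (e : AugmentedChainFunctor R X) (q : ℕ) : Set X ⥤ ModuleCat.{u} R :=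
  e.chains ⋙ HomologicalComplex.eval _ _ q

/-- The natural transformation given by the differentials `e_q(Z) → e_{q'}(Z)`. -/
def differential (e : AugmentedChainFunctor R X) (q q' : ℕ) : e.component q ⟶ e.component q' where
  app Z := (e.chains.obj Z).d q q'
  naturality _ _ f := (e.chains.map f).comm q q'

lemma differential_comp (e : AugmentedChainFunctor R X) (q q' q'' : ℕ) :
    e.differential q q' ≫ e.differential q' q'' = 0 := by
  ext Z : 2
  exact (e.chains.obj Z).d_comp_d q q' q''

lemma differential_shape (e : AugmentedChainFunctor R X) (q q' : ℕ)
    (h : ¬ (ComplexShape.down ℕ).Rel q q') : e.differential q q' = 0 := by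
  ext Z : 2
  exact (e.chains.obj Z).shape q q' h

/-- The augmentation as a natural transformation `e_0 ⟶ R`. -/
def augmentation (e : AugmentedChainFunctor R X) :
    e.component 0 ⟶ (Functor.const (Set X)).obj (ModuleCat.of R R) := e.aug

lemma differential_augmentation (e : AugmentedChainFunctor R X) :
    e.differential 1 0 ≫ e.augmentation = 0 := by
  ext Z : 2
  exact e.d_aug Z

end AugmentedChainFunctor

/-! ### The double complex of a covering -/

section DoubleComplex

variable {R : Type u} [Ring R] {X : Type u} {ι : Type u} [LinearOrder ι]

/-- The double complex `c_p(N, e_q) = ⨁_{σ ∈ N_p} e_q(|σ|)` of the covering; here the first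
(outer) index is `q` and the second (inner) index is `p`. Its two differentials commute. -/
abbrev doubleComplex (e : AugmentedChainFunctor R X) (U : ι → Set X) :
    HomologicalComplex₂ (ModuleCat.{u} R) (ComplexShape.down ℕ) (ComplexShape.down ℕ) where
  X q := nerveChains U (e.component q)
  d q q' := nerveChainsMap U (e.differential q q')
  shape q q' h := by rw [e.differential_shape q q' h, nerveChainsMap_zero]
  d_comp_d' q q' q'' _ _ := by
    rw [nerveChainsMap_comp, e.differential_comp, nerveChainsMap_zero]

/-- The total complex `t_•(N, e)`, with `t_n = ⨁_{p + q = n} c_p(N, e_q)` and with differential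
`d + (-1)^q δ` on `c_p(N, e_q)`. -/
abbrev totalComplex (e : AugmentedChainFunctor R X) (U : ι → Set X) :
    ChainComplex (ModuleCat.{u} R) ℕ :=
  (doubleComplex e U).total (ComplexShape.down ℕ)

/-- The complex `C_•(N)` of simplicial chains of the nerve with coefficients in `R`, that is,
`C_p(N) = ⨁_{σ ∈ N_p} R` with the usual simplicial boundary. -/
abbrev simplicialChains (R : Type u) [Ring R] (U : ι → Set X) : ChainComplex (ModuleCat.{u} R) ℕ :=
  nerveChains U ((Functor.const (Set X)).obj (ModuleCat.of R R))

lemma total_d_desc (e : AugmentedChainFunctor R X) (U : ι → Set X) {A : ModuleCat.{u} R}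
    (q p n m : ℕ) (h : q + p = n)
    (f : ∀ (q p : ℕ) (_ : q + p = m), ((doubleComplex e U).X q).X p ⟶ A) :
    (doubleComplex e U).ιTotal (ComplexShape.down ℕ) q p n h ≫ (totalComplex e U).d n m ≫
        (doubleComplex e U).totalDesc f =
      ((doubleComplex e U).d₁ (ComplexShape.down ℕ) q p m) ≫ (doubleComplex e U).totalDesc f +
      ((doubleComplex e U).d₂ (ComplexShape.down ℕ) q p m) ≫ (doubleComplex e U).totalDesc f := by
  rw [HomologicalComplex₂.total_d, Preadditive.add_comp, Preadditive.comp_add,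
    HomologicalComplex₂.ι_D₁_assoc, HomologicalComplex₂.ι_D₂_assoc]

/-- The components of `λ_e`: the augmentation on `c_n(N, e_0)`, zero on `c_p(N, e_q)`, `q > 0`. -/
def lambdaSummand (e : AugmentedChainFunctor R X) (U : ι → Set X) {n : ℕ} (q p : ℕ)
    (h : q + p = n) : ((doubleComplex e U).X q).X p ⟶ (simplicialChains R U).X n :=
  match q, h with
  | 0, h => (nerveChainsMap U e.augmentation).f p ≫
      ((simplicialChains R U).XIsoOfEq (show p = n by omega)).hom
  | _ + 1, _ => 0

/-- The components of `τ_e`: the map `δ_0` on `c_0(N, e_n)`, zero on `c_p(N, e_q)`, `p > 0`. -/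
def tauSummand (e : AugmentedChainFunctor R X) (U : ι → Set X) {n : ℕ} (q p : ℕ)
    (h : q + p = n) : ((doubleComplex e U).X q).X p ⟶ (e.chains.obj Set.univ).X n :=
  match p, h with
  | 0, h => nerveAugmentation U (e.component q) ≫
      ((e.chains.obj Set.univ).XIsoOfEq (show q = n by omega)).hom
  | _ + 1, _ => 0

lemma d₂_lambda (e : AugmentedChainFunctor R X) (U : ι → Set X) (q p m : ℕ) :
    (doubleComplex e U).d₂ (ComplexShape.down ℕ) (q + 1) p m ≫
      (doubleComplex e U).totalDesc (fun q p h => lambdaSummand (n := m) e U q p h) = 0 := by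
  by_cases hp : (ComplexShape.down ℕ).Rel p ((ComplexShape.down ℕ).next p)
  · by_cases hm : q + 1 + (ComplexShape.down ℕ).next p = m
    · rw [HomologicalComplex₂.d₂_eq _ _ _ hp _ hm, Linear.units_smul_comp, Category.assoc,
        HomologicalComplex₂.ι_totalDesc]
      change _ • (_ ≫ 0) = 0
      rw [comp_zero, smul_zero]
    · rw [HomologicalComplex₂.d₂_eq_zero' _ _ _ hp _ hm, zero_comp]
  · rw [HomologicalComplex₂.d₂_eq_zero _ _ _ _ _ hp, zero_comp]

/-- The morphism `λ_e : t_•(N, e) ⟶ C_•(N)` given by the augmentations `e_0(|σ|) → R`. -/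
def lambda (e : AugmentedChainFunctor R X) (U : ι → Set X) :
    totalComplex e U ⟶ simplicialChains R U where
  f _ := (doubleComplex e U).totalDesc (fun q p h => lambdaSummand e U q p h)
  comm' n m hnm := by
    obtain rfl : m + 1 = n := hnm
    apply HomologicalComplex₂.total.hom_ext
    intro q p h
    have h' : q + p = m + 1 := h
    rw [total_d_desc, HomologicalComplex₂.ι_totalDesc_assoc]
    match q, p, h' with
    | 0, p + 1, h' =>
      obtain rfl : p = m := by omega
      rw [HomologicalComplex₂.d₁_eq_zero _ _ _ _ _ (by simp),
        HomologicalComplex₂.d₂_eq _ _ 0 (show (ComplexShape.down ℕ).Rel (p + 1) p from rfl) _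
          (show 0 + p = p by omega), zero_comp, zero_add,
        show (ComplexShape.down ℕ).ε₂ (ComplexShape.down ℕ) (ComplexShape.down ℕ) (0, p + 1) = 1
          from rfl, one_smul, Category.assoc, HomologicalComplex₂.ι_totalDesc]
      have hl : ∀ (k : ℕ) (hk : 0 + k = k),
          lambdaSummand e U 0 k hk = (nerveChainsMap U e.augmentation).f k :=
        fun k _ => Category.comp_id _
      rw [hl, hl]
      exact (nerveChainsMap U e.augmentation).comm (p + 1) p
    | 1, p, h' =>
      obtain rfl : p = m := by omega
      rw [HomologicalComplex₂.d₁_eq _ _ (show (ComplexShape.down ℕ).Rel 1 0 from rfl) p _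
          (show 0 + p = p by omega),
        show (ComplexShape.down ℕ).ε₁ (ComplexShape.down ℕ) (ComplexShape.down ℕ) (1, p) = 1
          from rfl, one_smul, Category.assoc, HomologicalComplex₂.ι_totalDesc]
      have hl : lambdaSummand e U 0 p (show 0 + p = p by omega) =
          (nerveChainsMap U e.augmentation).f p := Category.comp_id _
      have h1 : ((doubleComplex e U).d 1 0).f p ≫
          lambdaSummand e U 0 p (show 0 + p = p by omega) = 0 := by
        rw [hl]
        have := congrArg (fun ψ => ψ.f p)
          (nerveChainsMap_comp U (e.differential 1 0) e.augmentation)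
        rw [e.differential_augmentation, nerveChainsMap_zero] at this
        exact this
      rw [h1, d₂_lambda, add_zero]
      exact zero_comp
    | q + 2, p, h' =>
      rw [HomologicalComplex₂.d₁_eq _ _ (show (ComplexShape.down ℕ).Rel (q + 2) (q + 1) from rfl) p
        _ (show q + 1 + p = m by omega), d₂_lambda, add_zero, Linear.units_smul_comp,
        Category.assoc, HomologicalComplex₂.ι_totalDesc]
      change 0 ≫ _ = _ • (_ ≫ 0)
      rw [zero_comp, comp_zero, smul_zero]

lemma d₁_tau (e : AugmentedChainFunctor R X) (U : ι → Set X) (q p m : ℕ) :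
    (doubleComplex e U).d₁ (ComplexShape.down ℕ) q (p + 1) m ≫
      (doubleComplex e U).totalDesc (fun q p h => tauSummand (n := m) e U q p h) = 0 := by
  by_cases hq : (ComplexShape.down ℕ).Rel q ((ComplexShape.down ℕ).next q)
  · by_cases hm : (ComplexShape.down ℕ).next q + (p + 1) = m
    · rw [HomologicalComplex₂.d₁_eq _ _ hq _ _ hm, Linear.units_smul_comp, Category.assoc,
        HomologicalComplex₂.ι_totalDesc]
      change _ • (_ ≫ 0) = 0
      rw [comp_zero, smul_zero]
    · rw [HomologicalComplex₂.d₁_eq_zero' _ _ hq _ _ hm, zero_comp]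
  · rw [HomologicalComplex₂.d₁_eq_zero _ _ _ _ _ hq, zero_comp]

/-- The morphism `τ_e : t_•(N, e) ⟶ e_•(X)` given by the inclusions `|σ| ⊆ X`, where the
augmentation term is removed from `e_•(X)`. -/
def tau (e : AugmentedChainFunctor R X) (U : ι → Set X) :
    totalComplex e U ⟶ e.chains.obj Set.univ where
  f _ := (doubleComplex e U).totalDesc (fun q p h => tauSummand e U q p h)
  comm' n m hnm := by
    obtain rfl : m + 1 = n := hnm
    apply HomologicalComplex₂.total.hom_ext
    intro q p h
    have h' : q + p = m + 1 := h
    rw [total_d_desc, HomologicalComplex₂.ι_totalDesc_assoc]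
    have hl : ∀ (k : ℕ) (hk : k + 0 = k),
        tauSummand e U k 0 hk = nerveAugmentation U (e.component k) :=
      fun k _ => Category.comp_id _
    match q, p, h' with
    | q + 1, 0, h' =>
      obtain rfl : q = m := by omega
      rw [HomologicalComplex₂.d₂_eq_zero _ _ _ _ _ (by simp),
        HomologicalComplex₂.d₁_eq _ _ (show (ComplexShape.down ℕ).Rel (q + 1) q from rfl) _ _
          (show q + 0 = q by omega), zero_comp, add_zero,
        show (ComplexShape.down ℕ).ε₁ (ComplexShape.down ℕ) (ComplexShape.down ℕ) (q + 1, 0) = 1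
          from rfl, one_smul, Category.assoc, HomologicalComplex₂.ι_totalDesc]
      rw [hl, hl]
      exact (nerveChainsMap_augmentation U (e.differential (q + 1) q)).symm
    | q, 1, h' =>
      obtain rfl : q = m := by omega
      rw [d₁_tau, zero_add,
        HomologicalComplex₂.d₂_eq _ _ q (show (ComplexShape.down ℕ).Rel 1 0 from rfl) _
          (show q + 0 = q by omega), Linear.units_smul_comp, Category.assoc,
        HomologicalComplex₂.ι_totalDesc, hl]
      have h1 := nerveChains_d_augmentation U (e.component q)
      exact zero_comp.trans ((congrArg (fun ψ => (ComplexShape.down ℕ).ε₂ (ComplexShape.down ℕ)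
        (ComplexShape.down ℕ) (q, 1) • ψ) h1).trans (smul_zero _)).symm
    | q, p + 2, h' =>
      rw [d₁_tau, zero_add,
        HomologicalComplex₂.d₂_eq _ _ q (show (ComplexShape.down ℕ).Rel (p + 2) (p + 1) from rfl) _
          (show q + (p + 1) = m by omega), Linear.units_smul_comp, Category.assoc,
        HomologicalComplex₂.ι_totalDesc]
      change 0 ≫ _ = _ • (_ ≫ 0)
      rw [zero_comp, comp_zero, smul_zero]

end DoubleComplex

/-! ### Singular chains -/

/-- A subset of `X`, as a topological space with the subspace topology. -/
def subspaces (X : Type u) [TopologicalSpace X] : Set X ⥤ TopCat.{u} where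
  obj Z := TopCat.of Z
  map f := TopCat.ofHom ⟨Set.inclusion (leOfHom f), continuous_inclusion (leOfHom f)⟩

/-- The augmentation on the `0`-chains of a simplicial set: every `0`-simplex has value `1`. -/
def chainAugmentation (R : Type u) [Ring R] (S : SSet.{u}) :
    (S.chainComplex (ModuleCat.of R R)).X 0 ⟶ ModuleCat.of R R :=
  Sigma.desc (fun _ => 𝟙 (ModuleCat.of R R))

lemma ι_chainAugmentation (R : Type u) [Ring R] (S : SSet.{u})
    (x : S.obj (Opposite.op (SimplexCategory.mk 0))) :
    S.ιChainComplex (R := ModuleCat.of R R) x ≫ chainAugmentation R S = 𝟙 _ :=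
  Sigma.ι_desc _ _

lemma chainComplexMap_augmentation (R : Type u) [Ring R] {S T : SSet.{u}} (f : S ⟶ T) :
    (SSet.chainComplexMap f (ModuleCat.of R R)).f 0 ≫ chainAugmentation R T =
      chainAugmentation R S := by
  apply SSet.chainComplex_hom_ext
  intro x
  rw [SSet.ι_chainComplexMap_f_assoc, ι_chainAugmentation, ι_chainAugmentation]

lemma chainComplex_d_augmentation (R : Type u) [Ring R] (S : SSet.{u}) :
    (S.chainComplex (ModuleCat.of R R)).d 1 0 ≫ chainAugmentation R S = 0 := by
  apply SSet.chainComplex_hom_ext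
  intro x
  rw [SSet.ιChainComplex_d_assoc, Preadditive.sum_comp]
  simp [Fin.sum_univ_two, ι_chainAugmentation]

/-- The functor of singular chains with coefficients in `R`, with the usual augmentation. -/
def singularChains (R : Type u) [Ring R] (X : Type u) [TopologicalSpace X] :
    AugmentedChainFunctor R X where
  chains := subspaces X ⋙
    (AlgebraicTopology.singularChainComplexFunctor (ModuleCat.{u} R)).obj (ModuleCat.of R R)
  aug :=
    { app Z := chainAugmentation R (TopCat.toSSet.obj (TopCat.of Z))
      naturality _ _ f := (chainComplexMap_augmentation R
        (TopCat.toSSet.map ((subspaces X).map f))).trans (Category.comp_id _).symm }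
  d_aug Z := chainComplex_d_augmentation R (TopCat.toSSet.obj (TopCat.of Z))

/-! ### The canonical homomorphism -/

/-- The canonical homomorphism `λ_{C*} ∘ τ_{C*}⁻¹ : H_n(X) → H_n(N)`, which is defined when the
map `τ_{C*}` is an isomorphism. -/
def canonicalMap (R : Type u) [Ring R] {X : Type u} [TopologicalSpace X] {ι : Type u}
    [LinearOrder ι] (U : ι → Set X) (n : ℕ)
    [IsIso (HomologicalComplex.homologyMap (tau (singularChains R X) U) n)] :
    (singularChains R X).homology Set.univ n ⟶ (simplicialChains R U).homology n :=
  inv (HomologicalComplex.homologyMap (tau (singularChains R X) U) n) ≫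
    HomologicalComplex.homologyMap (lambda (singularChains R X) U) n

end HomologicalLeray

end

noncomputable section

namespace HomologicalLeray

/-! ### Homology of complexes of modules in terms of elements -/

section Homology

variable {R : Type u} [Ring R]

/-! The map `g` is the composite of the inverse of `λ_e` with `τ_e` in homology. A natural
transformation `φ` induces a morphism of total complexes `t(φ)` with `λ_e ∘ t(φ) = λ_C`
(`totalComplexMap_lambda`) and `τ_e ∘ t(φ) = φ ∘ τ_C` (`totalComplexMap_tau`). If `λ_e` and `τ_C`
are isomorphisms in homology, then `φ_* = τ_{e*} λ_{e*}⁻¹ λ_{C*} τ_{C*}⁻¹`, which is the assertion.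

Both isomorphisms come from one criterion, `isIso_homologyMap_of_bigraded`. Consider a map from a
total complex that lives on one edge of the double complex. If the lines augmented by it are exact,
the usual zigzag shows that every cycle in its kernel is the boundary of a chain in its kernel. If
moreover each chain of the target whose boundary lies in the image is itself in the image up to a
boundary, the map is a quasi-isomorphism.

For `λ_e` (`isIso_homologyMap_lambda`) the lines are direct sums of the augmented complexes
`e_•(|σ|)`, exact by acyclicity, and `λ_e` is surjective.

For `τ_C` (`isIso_homologyMap_tau`) fix a singular simplex `f`. The simplices `σ` with `f` in `|σ|`
are all the finite non-empty subsets of `{i | f ⊂ U i}`, hence form a full simplex, and coning off a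
chosen index contracts the line (`columnHomotopy_spec`). The image of `τ_C` consists of the small
chains, and the condition on the target is the theorem on small chains, `exists_sub_boundary_small`.

That theorem is proved by barycentric subdivision. Subdivision and its homotopy to the identity are
built once, as formal integer combinations of affine maps between standard simplices, and act on
singular chains by precomposition. Subdivision shrinks the `n`-simplex by the factor `n / (n + 1)`,
so a Lebesgue number argument makes any chain small after finitely many iterations. -/

lemma exists_cycles {K : ChainComplex (ModuleCat.{u} R) ℕ} {n : ℕ} (z : K.X n)
    (hz : ∀ j, K.d n j z = 0) : ∃ c : K.cycles n, K.iCycles n c = z := by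
  have h := (ShortComplex.exact_of_f_is_kernel
    (ShortComplex.mk (K.iCycles n) (K.d n ((ComplexShape.down ℕ).next n)) (by simp))
    (K.cyclesIsKernel n _ rfl))
  exact (ShortComplex.moduleCat_exact_iff _).1 h z (hz _)

lemma exists_boundary {K : ChainComplex (ModuleCat.{u} R) ℕ} {n : ℕ} (c : K.cycles n)
    (hc : K.homologyπ n c = 0) : ∃ w : K.X (n + 1), K.d (n + 1) n w = K.iCycles n c := by
  have h := (ShortComplex.exact_of_g_is_cokernel
    (ShortComplex.mk (K.toCycles (n + 1) n) (K.homologyπ n) (by simp))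
    (K.homologyIsCokernel (n + 1) n (by simp)))
  obtain ⟨w, hw⟩ := (ShortComplex.moduleCat_exact_iff _).1 h c hc
  refine ⟨w, ?_⟩
  have := ConcreteCategory.congr_hom (K.toCycles_i (n + 1) n) w
  rw [← this]
  exact congrArg (K.iCycles n) hw

lemma iCycles_injective (K : ChainComplex (ModuleCat.{u} R) ℕ) (n : ℕ) :
    Function.Injective (K.iCycles n) :=
  (ModuleCat.mono_iff_injective _).1 inferInstance

lemma homologyπ_surjective (K : ChainComplex (ModuleCat.{u} R) ℕ) (n : ℕ) :
    Function.Surjective (K.homologyπ n) :=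
  (ModuleCat.epi_iff_surjective _).1 inferInstance

lemma homologyπ_eq_zero {K : ChainComplex (ModuleCat.{u} R) ℕ} {n : ℕ} (c : K.cycles n)
    (w : K.X (n + 1)) (hw : K.d (n + 1) n w = K.iCycles n c) : K.homologyπ n c = 0 := by
  have : c = K.toCycles (n + 1) n w := iCycles_injective K n (by
    rw [← hw]; exact (ConcreteCategory.congr_hom (K.toCycles_i (n + 1) n) w).symm)
  rw [this]
  exact ConcreteCategory.congr_hom (K.toCycles_comp_homologyπ (n + 1) n) w

/-- Here `hs` gives surjectivity and `hi` injectivity on homology, in terms of elements. -/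
lemma isIso_homologyMap_of_elements {T A : ChainComplex (ModuleCat.{u} R) ℕ} (f : T ⟶ A) (n : ℕ)
    (hs : ∀ a : A.X n, (∀ j, A.d n j a = 0) →
      ∃ t : T.X n, (∀ j, T.d n j t = 0) ∧ ∃ a', a - f.f n t = A.d (n + 1) n a')
    (hi : ∀ t : T.X n, (∀ j, T.d n j t = 0) → ∀ a, f.f n t = A.d (n + 1) n a →
      ∃ t', t = T.d (n + 1) n t') :
    IsIso (HomologicalComplex.homologyMap f n) := by
  have hd : ∀ (K : ChainComplex (ModuleCat.{u} R) ℕ) (c : K.cycles n) j,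
      K.d n j (K.iCycles n c) = 0 := fun K c j =>
    ConcreteCategory.congr_hom (K.iCycles_d n j) c
  have hπ : ∀ c, HomologicalComplex.homologyMap f n (T.homologyπ n c) =
      A.homologyπ n (HomologicalComplex.cyclesMap f n c) := fun c =>
    ConcreteCategory.congr_hom (HomologicalComplex.homologyπ_naturality f n) c
  have hc : ∀ c, A.iCycles n (HomologicalComplex.cyclesMap f n c) = f.f n (T.iCycles n c) :=
    fun c => ConcreteCategory.congr_hom (HomologicalComplex.cyclesMap_i f n) c
  rw [ConcreteCategory.isIso_iff_bijective]
  constructor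
  · rw [injective_iff_map_eq_zero]
    intro x hx
    obtain ⟨c, rfl⟩ := homologyπ_surjective T n x
    rw [hπ] at hx
    obtain ⟨a, ha⟩ := exists_boundary _ hx
    rw [hc] at ha
    obtain ⟨t', ht'⟩ := hi _ (hd T c) a ha.symm
    exact homologyπ_eq_zero c t' ht'.symm
  · intro y
    obtain ⟨c, rfl⟩ := homologyπ_surjective A n y
    obtain ⟨t, ht, a', ha'⟩ := hs _ (hd A c)
    obtain ⟨c', rfl⟩ := exists_cycles t ht
    refine ⟨T.homologyπ n c', ?_⟩
    rw [hπ, ← sub_eq_zero, ← map_sub]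
    have : A.homologyπ n (c - HomologicalComplex.cyclesMap f n c') = 0 :=
      homologyπ_eq_zero _ a' (by rw [← ha', map_sub, hc])
    rw [← neg_sub, map_neg, this, neg_zero]

lemma d_comp_d_apply (K : ChainComplex (ModuleCat.{u} R) ℕ) (i j k : ℕ) (x : K.X i) :
    K.d j k (K.d i j x) = 0 :=
  ConcreteCategory.congr_hom (K.d_comp_d i j k) x

lemma f_comm_apply {T A : ChainComplex (ModuleCat.{u} R) ℕ} (f : T ⟶ A) (i j : ℕ) (x : T.X i) :
    f.f j (T.d i j x) = A.d i j (f.f i x) :=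
  (ConcreteCategory.congr_hom (f.comm i j) x).symm

/-- A morphism `f : T ⟶ A` of complexes that vanishes on the first step of a finite filtration of
`T` induces isomorphisms in homology, if cycles can be moved along the filtration and if chains of
`A` whose boundary comes from `T` come from `T` up to boundaries. -/
lemma isIso_homologyMap_of_filtration {T A : ChainComplex (ModuleCat.{u} R) ℕ} (f : T ⟶ A)
    (F : ∀ n, ℕ → Submodule R (T.X n)) (hF : ∀ n, F n (n + 1) = ⊥) (hF0 : ∀ n, F n 0 = ⊤)
    (hf : ∀ n, ∀ t ∈ F n 1, f.f n t = 0)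
    (hanti : ∀ n k, F n (k + 1) ≤ F n k)
    (hstep : ∀ n k, ∀ z ∈ F n k, f.f n z = 0 → (∀ j, T.d n j z = 0) →
      ∃ w ∈ F (n + 1) (k + 1), z - T.d (n + 1) n w ∈ F n (k + 1))
    (hA : ∀ n (a : A.X n), (∀ j, ∃ t, A.d n j a = f.f j t) →
      ∃ t a', a = A.d (n + 1) n a' + f.f n t) (n : ℕ) :
    IsIso (HomologicalComplex.homologyMap f n) := by
  have hF1 : ∀ n k, F n (k + 1) ≤ F n 1 := fun n k => by
    induction k with
    | zero => exact le_rfl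
    | succ k ih => exact (hanti n _).trans ih
  -- Descending induction on the filtration degree, which ends because `F n (n + 1) = ⊥`. The
  -- correcting chains lie in `F (n + 1) 1`, where `f` vanishes, so the corrected cycle stays in the
  -- kernel of `f`.
  have key : ∀ n l k, k + l = n + 1 → ∀ z ∈ F n k, f.f n z = 0 → (∀ j, T.d n j z = 0) →
      ∃ w ∈ F (n + 1) 1, z = T.d (n + 1) n w := by
    intro n l
    induction l with
    | zero =>
      intro k hk z hz _ _
      obtain rfl : k = n + 1 := by omega
      rw [hF, Submodule.mem_bot] at hz
      exact ⟨0, zero_mem _, by rw [hz, map_zero]⟩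
    | succ l ih =>
      intro k hk z hz hfz hdz
      obtain ⟨w, hw, hzw⟩ := hstep n k z hz hfz hdz
      obtain ⟨w', hw', h⟩ := ih (k + 1) (by omega) _ hzw
        (by rw [map_sub, hfz, f_comm_apply, hf _ _ (hF1 _ _ hw), map_zero, sub_zero])
        (fun j => by rw [map_sub, hdz, d_comp_d_apply, sub_zero])
      exact ⟨w + w', add_mem (hF1 _ _ hw) hw', by rw [map_add, ← h]; abel⟩
  have key0 : ∀ n z, f.f n z = 0 → (∀ j, T.d n j z = 0) →
      ∃ w ∈ F (n + 1) 1, z = T.d (n + 1) n w := fun n z =>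
    key n (n + 1) 0 (by omega) z (by rw [hF0]; trivial)
  apply isIso_homologyMap_of_elements
  · intro a ha
    obtain ⟨t, a', h⟩ := hA n a (fun j => ⟨0, by rw [ha, map_zero]⟩)
    -- The preimage `t` need not be a cycle, but its boundary is a cycle killed by `f`. By `key0` it
    -- bounds some `w` killed by `f`, and `t - w` is a cycle with the same image.
    have hft : ∀ j, f.f j (T.d n j t) = 0 := fun j => by
      have := congrArg (A.d n j) h
      rw [ha, map_add, d_comp_d_apply, zero_add] at this
      rw [f_comm_apply, ← this]
    obtain _ | m := n
    · exact ⟨t, fun j => by rw [T.shape 0 j (by simp)]; rfl, a', by rw [h]; abel⟩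
    · obtain ⟨w, hw, h'⟩ := key0 m (T.d (m + 1) m t) (hft m)
        (fun j => d_comp_d_apply _ _ _ _ _)
      refine ⟨t - w, fun j => ?_, a', by rw [h, map_sub, hf _ _ hw]; abel⟩
      by_cases hj : j = m
      · subst hj
        rw [map_sub, ← h', sub_self]
      · rw [T.shape _ _ (by simpa using fun h => hj (by omega))]
        rfl
  · intro t ht a ha
    -- The bounding chain `a` has boundary `f t`, so it can be replaced by the image of some `x`.
    -- Then `t - d x` is a cycle killed by `f`.
    obtain ⟨x, a', h⟩ := hA (n + 1) a (fun j => by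
      by_cases hj : j = n
      · subst hj
        exact ⟨t, ha.symm⟩
      · exact ⟨0, by rw [A.shape _ _ (by simpa using fun h => hj (by omega)), map_zero]; rfl⟩)
    obtain ⟨w, -, hw⟩ := key0 n (t - T.d (n + 1) n x)
      (by rw [map_sub, ha, f_comm_apply, h, map_add, d_comp_d_apply]; abel)
      (fun j => by rw [map_sub, ht, d_comp_d_apply, sub_zero])
    exact ⟨w + x, by rw [map_add, ← hw]; abel⟩

end Homology

/-! ### Total complexes -/

section Bigraded

variable {R : Type u} [Ring R] {T A : ChainComplex (ModuleCat.{u} R) ℕ}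
  {M : ℕ → ℕ → ModuleCat.{u} R} (ι : ∀ k b n, k + b = n → (M k b ⟶ T.X n))

/-- The filtration of `T` by the first degree, where `T` has a bigrading with summands `M k b`. -/
def bigradedFiltration (n k : ℕ) : Submodule R (T.X n) :=
  Submodule.span R {t | ∃ k' b h, k ≤ k' ∧ ∃ x, ι k' b n h x = t}

lemma mem_bigradedFiltration {n k k' b : ℕ} (h : k' + b = n) (hk : k ≤ k') (x : M k' b) :
    ι k' b n h x ∈ bigradedFiltration ι n k :=
  Submodule.subset_span ⟨k', b, h, hk, x, rfl⟩

lemma bigradedFiltration_anti (n : ℕ) {k k' : ℕ} (h : k ≤ k') :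
    bigradedFiltration ι n k' ≤ bigradedFiltration ι n k := by
  refine Submodule.span_mono ?_
  rintro _ ⟨l, b, hl, hk, x, rfl⟩
  exact ⟨l, b, hl, h.trans hk, x, rfl⟩

lemma bigradedFiltration_eq_bot (n k : ℕ) (h : n < k) : bigradedFiltration ι n k = ⊥ := by
  rw [bigradedFiltration, Submodule.span_eq_bot]
  rintro _ ⟨l, b, hl, hk, x, rfl⟩
  omega

/-- The leading term: in total degree `n`, the only summand with first degree exactly `k` is `M k
b`. -/
lemma exists_sub_mem_bigradedFiltration {k b n : ℕ} (h : k + b = n) {z : T.X n}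
    (hz : z ∈ bigradedFiltration ι n k) :
    ∃ x, z - ι k b n h x ∈ bigradedFiltration ι n (k + 1) := by
  induction hz using Submodule.span_induction with
  | mem z hz =>
    obtain ⟨l, b', hl, hk, x, rfl⟩ := hz
    obtain rfl | hk := hk.eq_or_lt
    · obtain rfl : b = b' := by omega
      exact ⟨x, by rw [sub_self]; exact zero_mem _⟩
    · exact ⟨0, by rw [map_zero, sub_zero]; exact mem_bigradedFiltration ι hl hk x⟩
  | zero => exact ⟨0, by rw [map_zero, sub_zero]; exact zero_mem _⟩
  | add z z' _ _ h h' =>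
    obtain ⟨x, hx⟩ := h
    obtain ⟨x', hx'⟩ := h'
    refine ⟨x + x', ?_⟩
    rw [map_add, add_sub_add_comm]
    exact add_mem hx hx'
  | smul r z _ h =>
    obtain ⟨x, hx⟩ := h
    refine ⟨r • x, ?_⟩
    rw [map_smul, ← smul_sub]
    exact Submodule.smul_mem _ _ hx

/-- If `T` is the total complex of a double complex with summands `M k b`, and `f : T ⟶ A` vanishes
on the summands with `k > 0`, then `f` is a quasi-isomorphism as soon as the sequences
`… → M 1 b → M 0 b → A b` are exact and every chain of `A` whose boundary is in the image of `f`
is in the image of `f` up to a boundary. -/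
lemma isIso_homologyMap_of_bigraded (f : T ⟶ A) (δ : ∀ k b, M (k + 1) b ⟶ M k b)
    (hspan : ∀ n, bigradedFiltration ι n 0 = ⊤)
    (hind : ∀ k b n h x, ι k b n h x ∈ bigradedFiltration ι n (k + 1) → x = 0)
    (hδ : ∀ k b n (h : k + b = n), ∃ s : ℤˣ, ∀ x,
      T.d (n + 1) n (ι (k + 1) b (n + 1) (by omega) x) - s • ι k b n h (δ k b x) ∈
        bigradedFiltration ι n (k + 1))
    (hf : ∀ k b n h x, f.f n (ι (k + 1) b n h x) = 0)
    (hex0 : ∀ b n h x, f.f n (ι 0 b n h x) = 0 → ∃ y, δ 0 b y = x)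
    (hex : ∀ k b x, δ k b x = 0 → ∃ y, δ (k + 1) b y = x)
    (hA : ∀ n (a : A.X n), (∀ j, ∃ t, A.d n j a = f.f j t) →
      ∃ t a', a = A.d (n + 1) n a' + f.f n t) (n : ℕ) :
    IsIso (HomologicalComplex.homologyMap f n) := by
  have hf1 : ∀ n, ∀ t ∈ bigradedFiltration ι n 1, f.f n t = 0 := fun n => by
    suffices bigradedFiltration ι n 1 ≤ LinearMap.ker (f.f n).hom from this
    refine Submodule.span_le.2 ?_
    rintro _ ⟨l, b, hl, hk, x, rfl⟩
    obtain ⟨l, rfl⟩ := Nat.exists_eq_add_of_le' hk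
    exact hf _ _ _ _ _
  -- The differential lowers the filtration degree by at most one, since its other component
  -- preserves the first degree.
  have hD : ∀ n k, ∀ t ∈ bigradedFiltration ι (n + 1) (k + 1),
      T.d (n + 1) n t ∈ bigradedFiltration ι n k := fun n k => by
    suffices bigradedFiltration ι (n + 1) (k + 1) ≤
      (bigradedFiltration ι n k).comap (T.d (n + 1) n).hom from this
    refine Submodule.span_le.2 ?_
    rintro _ ⟨l, b, hl, hk, x, rfl⟩
    obtain ⟨l, rfl⟩ := Nat.exists_eq_add_of_le' (le_trans (Nat.le_add_left 1 k) hk)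
    obtain ⟨s, hs⟩ := hδ l b n (by omega)
    have h1 := bigradedFiltration_anti ι n (k := k) (k' := l + 1) (by omega) (hs x)
    have h2 := mem_bigradedFiltration ι (show l + b = n by omega) (show k ≤ l by omega) (δ l b x)
    have := add_mem h1 (zsmul_mem h2 (s : ℤ))
    rwa [← Units.smul_def, sub_add_cancel] at this
  refine isIso_homologyMap_of_filtration f (bigradedFiltration ι)
    (fun n => bigradedFiltration_eq_bot ι n _ (Nat.lt_succ_self n)) hspan hf1
    (fun n k => bigradedFiltration_anti ι n (Nat.le_succ k)) ?_ hA n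
  intro n k z hz hfz hdz
  by_cases hk : n < k
  · rw [bigradedFiltration_eq_bot ι n k hk, Submodule.mem_bot] at hz
    exact ⟨0, zero_mem _, by rw [hz, map_zero, sub_zero]; exact zero_mem _⟩
  obtain ⟨b, hb⟩ := Nat.exists_eq_add_of_le (not_lt.1 hk)
  obtain ⟨x, hx⟩ := exists_sub_mem_bigradedFiltration ι hb.symm hz
  -- The leading term `x` of the cycle is killed by `δ`, or by `f` when `k = 0`, so it lifts by
  -- exactness. For `k > 0`, the leading part of `d z = 0` is `± δ x`, and `hind` detects its
  -- vanishing.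
  obtain ⟨y, rfl⟩ : ∃ y, δ k b y = x := by
    obtain _ | k := k
    · apply hex0 b n hb.symm
      have := hf1 _ _ hx
      rwa [map_sub, hfz, zero_sub, neg_eq_zero] at this
    · obtain ⟨m, rfl⟩ : ∃ m, n = m + 1 := ⟨k + b, by omega⟩
      apply hex k b
      obtain ⟨s, hs⟩ := hδ k b m (by omega)
      have h1 := hD _ _ _ hx
      rw [map_sub, hdz, zero_sub] at h1
      have h2 := sub_mem (neg_mem h1) (hs x)
      rw [neg_neg, sub_sub_cancel, Units.smul_def, ← map_zsmul] at h2
      have h3 := hind _ _ _ _ _ h2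
      obtain rfl | rfl := Int.units_eq_one_or s
      · simpa using h3
      · simpa using h3
  obtain ⟨s, hs⟩ := hδ k b n hb.symm
  -- The factor `s` cancels the sign of `δ` in the total differential, because `s * s = 1`.
  refine ⟨(s : ℤ) • ι (k + 1) b (n + 1) (by omega) y,
    zsmul_mem (mem_bigradedFiltration ι _ le_rfl y) _, ?_⟩
  have h1 := sub_mem hx (zsmul_mem (hs y) (s : ℤ))
  rw [smul_sub, ← Units.smul_def s (s • _), smul_smul, Int.units_mul_self, one_smul] at h1
  rw [map_zsmul]
  convert h1 using 1
  abel

end Bigraded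

/-! ### Edge maps out of the total complex of a double complex -/

section Total

variable {R : Type u} [Ring R]
  (K : HomologicalComplex₂ (ModuleCat.{u} R) (ComplexShape.down ℕ) (ComplexShape.down ℕ))

/-- The projection of the total complex to a summand. -/
def totalπ (q p n : ℕ) : (K.total (ComplexShape.down ℕ)).X n ⟶ (K.X q).X p :=
  K.totalDesc (fun q' p' _ => if h : q' = q ∧ p' = p then
    (K.XXIsoOfEq _ _ _ h.1 h.2).hom else 0)

lemma ιTotal_totalπ (q p n : ℕ) (h : q + p = n) :
    K.ιTotal (ComplexShape.down ℕ) q p n h ≫ totalπ K q p n = 𝟙 _ := by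
  rw [totalπ, HomologicalComplex₂.ι_totalDesc, dif_pos ⟨rfl, rfl⟩]
  simp

lemma ιTotal_totalπ_ne {q p q' p' n : ℕ} (h : q' + p' = n) (hne : ¬ (q' = q ∧ p' = p)) :
    K.ιTotal (ComplexShape.down ℕ) q' p' n h ≫ totalπ K q p n = 0 := by
  rw [totalπ, HomologicalComplex₂.ι_totalDesc, dif_neg hne]

/-- The quotient map by `N` vanishes on every summand, hence is zero. -/
lemma total_span (n : ℕ) (N : Submodule R ((K.total (ComplexShape.down ℕ)).X n))
    (hN : ∀ q p h x, K.ιTotal (ComplexShape.down ℕ) q p n h x ∈ N) : N = ⊤ := by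
  have : ModuleCat.ofHom N.mkQ = 0 := by
    apply HomologicalComplex₂.total.hom_ext
    intro q p h
    rw [comp_zero]
    ext x
    exact (Submodule.Quotient.mk_eq_zero N).2 (hN q p h x)
  rw [eq_top_iff]
  intro x _
  exact (Submodule.Quotient.mk_eq_zero N).1 (ConcreteCategory.congr_hom this x)

lemma sub_mem_of_eq_add {M : Type*} [AddCommGroup M] [Module R M] (N : Submodule R M) {a b c : M}
    (h : a = b + c) (hb : b ∈ N) : a - c ∈ N := by
  rwa [h, add_sub_cancel_right]

/-- The outer part of the differential keeps the inner degree `p + 1`, so it lands in `N`. The sign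
of the inner part is left unspecified because only its invertibility matters. -/
lemma total_d_inner (q p n : ℕ) (h : q + (p + 1) = n + 1)
    (N : Submodule R ((K.total (ComplexShape.down ℕ)).X n))
    (hN : ∀ q' y h, K.ιTotal (ComplexShape.down ℕ) q' (p + 1) n h y ∈ N) :
    ∃ s : ℤˣ, ∀ x, (K.total (ComplexShape.down ℕ)).d (n + 1) n
        (K.ιTotal (ComplexShape.down ℕ) q (p + 1) (n + 1) h x) -
      s • K.ιTotal (ComplexShape.down ℕ) q p n (by dsimp; omega) ((K.X q).d (p + 1) p x) ∈ N := by
  refine ⟨(ComplexShape.down ℕ).ε₂ (ComplexShape.down ℕ) (ComplexShape.down ℕ) (q, p + 1),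
    fun x => ?_⟩
  have := ConcreteCategory.congr_hom (show K.ιTotal (ComplexShape.down ℕ) q (p + 1) (n + 1) h ≫
    (K.total (ComplexShape.down ℕ)).d (n + 1) n = _ by
      rw [HomologicalComplex₂.total_d, Preadditive.comp_add, HomologicalComplex₂.ι_D₁,
        HomologicalComplex₂.ι_D₂,
        HomologicalComplex₂.d₂_eq _ _ _ (show (ComplexShape.down ℕ).Rel (p + 1) p from rfl) _
          (show q + p = n by omega)]) x
  have h1 : (K.d₁ (ComplexShape.down ℕ) q (p + 1) n) x ∈ N := by
    obtain _ | q := q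
    · rw [HomologicalComplex₂.d₁_eq_zero _ _ _ _ _ (by simp)]
      exact zero_mem _
    · rw [HomologicalComplex₂.d₁_eq _ _ (show (ComplexShape.down ℕ).Rel (q + 1) q from rfl) _ _
        (show q + (p + 1) = n by omega)]
      exact zsmul_mem (hN _ _ _) _
  exact sub_mem_of_eq_add N this h1

/-- The counterpart of `total_d_inner`: here the inner part of the differential is absorbed by `N`.
-/
lemma total_d_outer (q p n : ℕ) (h : q + 1 + p = n + 1)
    (N : Submodule R ((K.total (ComplexShape.down ℕ)).X n))
    (hN : ∀ p' y h, K.ιTotal (ComplexShape.down ℕ) (q + 1) p' n h y ∈ N) :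
    ∃ s : ℤˣ, ∀ x, (K.total (ComplexShape.down ℕ)).d (n + 1) n
        (K.ιTotal (ComplexShape.down ℕ) (q + 1) p (n + 1) h x) -
      s • K.ιTotal (ComplexShape.down ℕ) q p n (by dsimp; omega) ((K.d (q + 1) q).f p x) ∈ N := by
  refine ⟨(ComplexShape.down ℕ).ε₁ (ComplexShape.down ℕ) (ComplexShape.down ℕ) (q + 1, p),
    fun x => ?_⟩
  have := ConcreteCategory.congr_hom (show K.ιTotal (ComplexShape.down ℕ) (q + 1) p (n + 1) h ≫
    (K.total (ComplexShape.down ℕ)).d (n + 1) n = _ by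
      rw [HomologicalComplex₂.total_d, Preadditive.comp_add, HomologicalComplex₂.ι_D₁,
        HomologicalComplex₂.ι_D₂,
        HomologicalComplex₂.d₁_eq _ _ (show (ComplexShape.down ℕ).Rel (q + 1) q from rfl) _ _
          (show q + p = n by omega)]) x
  have h1 : (K.d₂ (ComplexShape.down ℕ) (q + 1) p n) x ∈ N := by
    obtain _ | p := p
    · rw [HomologicalComplex₂.d₂_eq_zero _ _ _ _ _ (by simp)]
      exact zero_mem _
    · rw [HomologicalComplex₂.d₂_eq _ _ _ (show (ComplexShape.down ℕ).Rel (p + 1) p from rfl) _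
        (show q + 1 + p = n by omega)]
      exact zsmul_mem (hN _ _ _) _
  exact sub_mem_of_eq_add N (this.trans (add_comm _ _)) h1

/-- An augmentation in the inner direction induces isomorphisms in homology if the columns are
exact and if chains whose boundary comes from the total complex do so up to a boundary. -/
lemma isIso_homologyMap_total_inner {A : ChainComplex (ModuleCat.{u} R) ℕ}
    (f : K.total (ComplexShape.down ℕ) ⟶ A)
    (hf : ∀ q p n h, K.ιTotal (ComplexShape.down ℕ) q (p + 1) n h ≫ f.f n = 0)
    (hex0 : ∀ n x, f.f n (K.ιTotal (ComplexShape.down ℕ) n 0 n rfl x) = 0 →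
      ∃ y, (K.X n).d 1 0 y = x)
    (hex : ∀ q p x, (K.X q).d (p + 1) p x = 0 → ∃ y, (K.X q).d (p + 2) (p + 1) y = x)
    (hA : ∀ n (a : A.X n), (∀ j, ∃ t, A.d n j a = f.f j t) →
      ∃ t a', a = A.d (n + 1) n a' + f.f n t) (n : ℕ) :
    IsIso (HomologicalComplex.homologyMap f n) := by
  -- The filtration is by the inner degree, so the two indices are exchanged.
  let ι : ∀ k b n, k + b = n → ((K.X b).X k ⟶ (K.total (ComplexShape.down ℕ)).X n) :=
    fun k b n h => K.ιTotal (ComplexShape.down ℕ) b k n (by dsimp; omega)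
  refine isIso_homologyMap_of_bigraded (M := fun k b => (K.X b).X k) ι f
    (fun k b => (K.X b).d (k + 1) k) ?_ ?_ ?_ ?_ ?_ ?_ hA n
  · intro n
    refine total_span K n _ fun q p h x => ?_
    exact mem_bigradedFiltration ι (show p + q = n by dsimp at h; omega) (Nat.zero_le _) x
  · intro k b n h x hx
    have : bigradedFiltration ι n (k + 1) ≤ LinearMap.ker (totalπ K b k n).hom := by
      refine Submodule.span_le.2 ?_
      rintro _ ⟨l, b', hl, hk, y, rfl⟩
      exact ConcreteCategory.congr_hom (ιTotal_totalπ_ne K _ (by omega)) y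
    have h' := this hx
    exact (ConcreteCategory.congr_hom (ιTotal_totalπ K b k n (by omega)) x).symm.trans h'
  · intro k b n h
    exact total_d_inner K b k n (by omega) _
      (fun q' y h' => mem_bigradedFiltration ι (show k + 1 + q' = n by dsimp at h'; omega) le_rfl y)
  · intro k b n h x
    exact ConcreteCategory.congr_hom (hf b k n (by dsimp; omega)) x
  · intro b n h x hx
    obtain rfl : b = n := by omega
    exact hex0 b x hx
  · exact fun k b x hx => hex b k x hx

/-- An augmentation in the outer direction induces isomorphisms in homology if the rows are
exact and if chains whose boundary comes from the total complex do so up to a boundary. -/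
lemma isIso_homologyMap_total_outer {A : ChainComplex (ModuleCat.{u} R) ℕ}
    (f : K.total (ComplexShape.down ℕ) ⟶ A)
    (hf : ∀ q p n h, K.ιTotal (ComplexShape.down ℕ) (q + 1) p n h ≫ f.f n = 0)
    (hex0 : ∀ n x, f.f n (K.ιTotal (ComplexShape.down ℕ) 0 n n (Nat.zero_add n) x) = 0 →
      ∃ y, (K.d 1 0).f n y = x)
    (hex : ∀ q p x, (K.d (q + 1) q).f p x = 0 → ∃ y, (K.d (q + 2) (q + 1)).f p y = x)
    (hA : ∀ n (a : A.X n), (∀ j, ∃ t, A.d n j a = f.f j t) →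
      ∃ t a', a = A.d (n + 1) n a' + f.f n t) (n : ℕ) :
    IsIso (HomologicalComplex.homologyMap f n) := by
  let ι : ∀ k b n, k + b = n → ((K.X k).X b ⟶ (K.total (ComplexShape.down ℕ)).X n) :=
    fun k b n h => K.ιTotal (ComplexShape.down ℕ) k b n h
  refine isIso_homologyMap_of_bigraded (M := fun k b => (K.X k).X b) ι f
    (fun k b => (K.d (k + 1) k).f b) ?_ ?_ ?_ ?_ ?_ ?_ hA n
  · intro n
    exact total_span K n _ fun q p h x => mem_bigradedFiltration ι h (Nat.zero_le _) x
  · intro k b n h x hx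
    have : bigradedFiltration ι n (k + 1) ≤ LinearMap.ker (totalπ K k b n).hom := by
      refine Submodule.span_le.2 ?_
      rintro _ ⟨l, b', hl, hk, y, rfl⟩
      exact ConcreteCategory.congr_hom (ιTotal_totalπ_ne K _ (by omega)) y
    have h' := this hx
    exact (ConcreteCategory.congr_hom (ιTotal_totalπ K k b n h) x).symm.trans h'
  · intro k b n h
    exact total_d_outer K k b n (by omega) _
      (fun q' y h' => mem_bigradedFiltration ι h' le_rfl y)
  · intro k b n h x
    exact ConcreteCategory.congr_hom (hf k b n h) x
  · intro b n h x hx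
    obtain rfl : b = n := by omega
    exact hex0 b x hx
  · exact fun k b x hx => hex k b x hx

end Total

/-! ### Exactness of the rows of the double complex -/

section Rows

variable {R : Type u} [Ring R] {X : Type u} {ι : Type u} [LinearOrder ι] (U : ι → Set X)

lemma nerveChainsMapX_apply {F G : Set X ⥤ ModuleCat.{u} R} (α : F ⟶ G) (p : ℕ)
    (x : DirectSum (Simplices U p) (fun σ => F.obj (support U σ.1))) (σ : Simplices U p) :
    (show DirectSum (Simplices U p) (fun σ => G.obj (support U σ.1)) from
      nerveChainsMapX U α p x) σ = α.app (support U σ.1) (x σ) := by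
  have : (DirectSum.component R _ (fun σ : Simplices U p => G.obj (support U σ.1)) σ) ∘ₗ
      (nerveChainsMapX U α p).hom =
      (α.app (support U σ.1)).hom ∘ₗ
        (DirectSum.component R _ (fun σ : Simplices U p => F.obj (support U σ.1)) σ) := by
    apply DirectSum.linearMap_ext
    intro τ
    ext y
    have h := ConcreteCategory.congr_hom (nerveι_mapX U α τ) y
    refine (congrArg (DirectSum.component R _
      (fun σ : Simplices U p => G.obj (support U σ.1)) σ) h).trans ?_
    change DirectSum.component R _ (fun σ : Simplices U p => G.obj (support U σ.1)) σ
      (DirectSum.lof R _ (fun σ : Simplices U p => G.obj (support U σ.1)) τ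
        (α.app (support U τ.1) y)) = α.app (support U σ.1) (DirectSum.component R _
          (fun σ : Simplices U p => F.obj (support U σ.1)) σ
          (DirectSum.lof R _ (fun σ : Simplices U p => F.obj (support U σ.1)) τ y))
    rw [DirectSum.component.of, DirectSum.component.of]
    split_ifs with h
    · subst h
      rfl
    · rw [map_zero]
  exact LinearMap.congr_fun this x

/-- A direct sum of exact sequences is exact: preimages are chosen summand by summand. -/
lemma nerveChainsMapX_exact {F G H : Set X ⥤ ModuleCat.{u} R} (α : F ⟶ G) (β : G ⟶ H) (p : ℕ)
    (h : ∀ σ ∈ nerve U, ∀ x, β.app (support U σ) x = 0 → ∃ y, α.app (support U σ) y = x)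
    (x : nerveChainsX U G p) (hx : nerveChainsMapX U β p x = 0) :
    ∃ y, nerveChainsMapX U α p y = x := by
  classical
  let x' : DirectSum (Simplices U p) (fun σ => G.obj (support U σ.1)) := x
  have hx' : ∀ σ : Simplices U p, β.app (support U σ.1) (x' σ) = 0 := fun σ => by
    rw [← nerveChainsMapX_apply]
    exact congrArg (fun z : DirectSum (Simplices U p) (fun σ => H.obj (support U σ.1)) => z σ) hx
  choose g hg using h
  -- The chosen preimage of `0` is forced to be `0`, so that the family of preimages has finite
  -- support.
  let g' : ∀ σ : Simplices U p, G.obj (support U σ.1) → F.obj (support U σ.1) := fun σ z =>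
    if hz : z ≠ 0 ∧ β.app (support U σ.1) z = 0 then g σ.1 σ.2.1 z hz.2 else 0
  have hg' : ∀ σ z, β.app (support U σ.1) z = 0 → α.app (support U σ.1) (g' σ z) = z := by
    intro σ z hz
    by_cases h0 : z = 0
    · subst h0
      simp [g']
    · simp only [g', dif_pos (show z ≠ 0 ∧ _ from ⟨h0, hz⟩)]
      exact hg _ _ _ _
  let y : DirectSum (Simplices U p) (fun σ => F.obj (support U σ.1)) :=
    DFinsupp.mapRange g' (fun σ => by simp [g']) x'
  refine ⟨y, DFinsupp.ext fun σ => ?_⟩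
  refine (nerveChainsMapX_apply U α p y σ).trans ?_
  rw [show y σ = g' σ (x' σ) from DFinsupp.mapRange_apply _ _ _ _]
  exact hg' σ _ (hx' σ)

/-- Augmenting shifts degrees by one: exactness in degrees `0`, `1` and `q + 2` gives the three
conclusions in order. -/
lemma exact_of_exactAt_augment {K : ChainComplex (ModuleCat.{u} R) ℕ} {M : ModuleCat.{u} R}
    (f : K.X 0 ⟶ M) (w : K.d 1 0 ≫ f = 0) (h : (K.augment f w).Acyclic) :
    (∀ m, ∃ y, f y = m) ∧ (∀ x, f x = 0 → ∃ y, K.d 1 0 y = x) ∧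
      ∀ q x, K.d (q + 1) q x = 0 → ∃ y, K.d (q + 2) (q + 1) y = x := by
  have h' : ∀ i j k, (ComplexShape.down ℕ).prev j = i → (ComplexShape.down ℕ).next j = k →
      ∀ x, (K.augment f w).d j k x = 0 → ∃ y, (K.augment f w).d i j y = x := fun i j k hi hk =>
    (ShortComplex.moduleCat_exact_iff _).1
      (((K.augment f w).exactAt_iff' i j k hi hk).1 (h j))
  refine ⟨fun m => h' 1 0 0 (by simp) (by simp) m ?_, h' 2 1 0 (by simp) (by simp),
    fun q => h' (q + 3) (q + 2) (q + 1) (by simp) (by simp)⟩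
  rw [(K.augment f w).shape 0 0 (by simp)]
  rfl

/-- If `U` is `e`-acyclic, then `λ_e` induces isomorphisms in homology. -/
theorem isIso_homologyMap_lambda (e : AugmentedChainFunctor R X) (he : e.IsAcyclicCover U)
    (n : ℕ) : IsIso (HomologicalComplex.homologyMap (lambda e U) n) := by
  have hex := fun σ hσ => exact_of_exactAt_augment _ _ (he σ hσ)
  have hl : ∀ n, (doubleComplex e U).ιTotal (ComplexShape.down ℕ) 0 n n (Nat.zero_add n) ≫
      (lambda e U).f n = nerveChainsMapX U e.augmentation n := fun n =>
    (HomologicalComplex₂.ι_totalDesc _ _ _ _ _).trans (Category.comp_id _)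
  refine isIso_homologyMap_total_outer (doubleComplex e U) (lambda e U) ?_ ?_ ?_ ?_ n
  · intro q p n h
    exact HomologicalComplex₂.ι_totalDesc _ _ _ _ _
  · intro n x hx
    exact nerveChainsMapX_exact U (e.differential 1 0) e.augmentation n
      (fun σ hσ => (hex σ hσ).2.1) x ((ConcreteCategory.congr_hom (hl n) x).symm.trans hx)
  · intro q p x hx
    exact nerveChainsMapX_exact U (e.differential (q + 2) (q + 1)) (e.differential (q + 1) q) p
      (fun σ hσ => (hex σ hσ).2.2 q) x hx
  · intro n a _
    -- Exactness of `e_0 → R → 0` makes `λ_e` surjective, so the condition on the target holds with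
    -- no boundary term.
    obtain ⟨y, hy⟩ := nerveChainsMapX_exact U e.augmentation
      (0 : _ ⟶ (Functor.const (Set X)).obj (ModuleCat.of R R)) n
      (fun σ hσ x _ => (hex σ hσ).1 x) a (by
        have := congrArg (fun ψ => ψ.f n) (nerveChainsMap_zero U
          ((Functor.const (Set X)).obj (ModuleCat.of R R))
          ((Functor.const (Set X)).obj (ModuleCat.of R R)))
        exact ConcreteCategory.congr_hom this a)
    refine ⟨(doubleComplex e U).ιTotal (ComplexShape.down ℕ) 0 n n (Nat.zero_add n) y, 0, ?_⟩
    rw [map_zero, zero_add]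
    exact hy.symm.trans (ConcreteCategory.congr_hom (hl n) y).symm

end Rows

/-! ### Functoriality of the total complex -/

section Naturality

variable {R : Type u} [Ring R] {X : Type u} {ι : Type u} [LinearOrder ι] (U : ι → Set X)
  {e e' : AugmentedChainFunctor R X} (φ : e.Hom e')

/-- The component of degree `q` of a natural transformation. -/
def AugmentedChainFunctor.Hom.component (q : ℕ) : e.component q ⟶ e'.component q :=
  Functor.whiskerRight φ.toNatTrans (HomologicalComplex.eval _ _ q)

/-- The morphism of double complexes induced by a natural transformation. -/
def doubleComplexMap : doubleComplex e U ⟶ doubleComplex e' U where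
  f q := nerveChainsMap U (φ.component q)
  comm' q q' _ := by
    change nerveChainsMap U _ ≫ nerveChainsMap U _ = nerveChainsMap U _ ≫ nerveChainsMap U _
    rw [nerveChainsMap_comp, nerveChainsMap_comp]
    congr 1
    ext Z : 2
    exact (φ.toNatTrans.app Z).comm q q'

/-- The morphism of total complexes induced by a natural transformation. -/
def totalComplexMap : totalComplex e U ⟶ totalComplex e' U :=
  HomologicalComplex₂.total.map (doubleComplexMap U φ) (ComplexShape.down ℕ)

lemma totalComplexMap_lambda : totalComplexMap U φ ≫ lambda e' U = lambda e U := by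
  ext n : 1
  apply HomologicalComplex₂.total.hom_ext
  intro q p h
  change _ ≫ (HomologicalComplex₂.total.map _ _).f n ≫ HomologicalComplex₂.totalDesc _ _ =
    _ ≫ HomologicalComplex₂.totalDesc _ _
  rw [HomologicalComplex₂.ιTotal_map_assoc, HomologicalComplex₂.ι_totalDesc,
    HomologicalComplex₂.ι_totalDesc]
  obtain _ | q := q
  · obtain rfl : p = n := by dsimp at h; omega
    have h1 := congrArg (fun ψ => ψ.f p)
      (nerveChainsMap_comp U (φ.component 0) e'.augmentation)
    have h2 : φ.component 0 ≫ e'.augmentation = e.augmentation := by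
      ext Z : 2
      exact φ.comp_aug Z
    rw [h2] at h1
    change _ ≫ _ ≫ 𝟙 _ = _ ≫ 𝟙 _
    rw [Category.comp_id, Category.comp_id]
    exact h1
  · exact comp_zero

lemma totalComplexMap_tau :
    totalComplexMap U φ ≫ tau e' U = tau e U ≫ φ.toNatTrans.app Set.univ := by
  ext n : 1
  apply HomologicalComplex₂.total.hom_ext
  intro q p h
  change _ ≫ (HomologicalComplex₂.total.map _ _).f n ≫ HomologicalComplex₂.totalDesc _ _ =
    _ ≫ HomologicalComplex₂.totalDesc _ _ ≫ (φ.toNatTrans.app Set.univ).f n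
  rw [HomologicalComplex₂.ιTotal_map_assoc, HomologicalComplex₂.ι_totalDesc,
    HomologicalComplex₂.ι_totalDesc_assoc]
  obtain _ | p := p
  · obtain rfl : q = n := by dsimp at h; omega
    have h1 := nerveChainsMap_augmentation U (φ.component q)
    exact (congrArg (_ ≫ ·) (Category.comp_id _)).trans
      (h1.trans (congrArg (· ≫ _) (Category.comp_id _).symm))
  · exact comp_zero.trans zero_comp.symm

end Naturality

/-! ### Singular simplices -/

section SingularSimplices

variable (R : Type u) [Ring R] {X : Type u} [TopologicalSpace X]

/-- The standard topological simplex of dimension `n`. -/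
abbrev Simplex (n : ℕ) : Type := stdSimplex ℝ (Fin (n + 1))

/-- The inclusion of the `i`-th face of the standard simplex. -/
def simplexFace (n : ℕ) (i : Fin (n + 2)) : C(Simplex n, Simplex (n + 1)) :=
  ⟨stdSimplex.map i.succAbove, stdSimplex.continuous_map _⟩

/-- A continuous map from the standard simplex to a subspace `Z`, as a simplex of the singular
simplicial set of `Z`. -/
def toSingular {Z : Set X} {n : ℕ} (f : C(Simplex n, X)) (h : ∀ t, f t ∈ Z) :
    (TopCat.toSSet.obj (TopCat.of Z)).obj (Opposite.op (SimplexCategory.mk n)) :=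
  (TopCat.toSSetObjEquiv (TopCat.of Z) (Opposite.op (SimplexCategory.mk n))).symm
    ⟨fun t => ⟨f t, h t⟩, by fun_prop⟩

lemma toSingular_surjective {Z : Set X} {n : ℕ}
    (s : (TopCat.toSSet.obj (TopCat.of Z)).obj (Opposite.op (SimplexCategory.mk n))) :
    ∃ f h, toSingular f h = s := by
  obtain ⟨g, rfl⟩ := (TopCat.toSSetObjEquiv (TopCat.of Z)
    (Opposite.op (SimplexCategory.mk n))).symm.surjective s
  refine ⟨⟨fun t => (g t).1, by fun_prop⟩, fun t => (g t).2, rfl⟩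

/-- The generator of the singular chains of `Z` given by a continuous map with values in `Z`. -/
def singularGen {Z : Set X} {n : ℕ} (f : C(Simplex n, X)) (h : ∀ t, f t ∈ Z) :
    ModuleCat.of R R ⟶ ((singularChains R X).component n).obj Z :=
  (TopCat.toSSet.obj (TopCat.of Z)).ιChainComplex (toSingular f h)

lemma singularGen_hom_ext {Z : Set X} {n : ℕ} {A : ModuleCat.{u} R}
    {a b : ((singularChains R X).component n).obj Z ⟶ A}
    (h : ∀ f hf, singularGen R f hf ≫ a = singularGen R f hf ≫ b) : a = b := by
  apply SSet.chainComplex_hom_ext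
  intro x
  obtain ⟨f, hf, rfl⟩ := toSingular_surjective x
  exact h f hf

lemma singularGen_d {Z : Set X} {n : ℕ} (f : C(Simplex (n + 1), X)) (h : ∀ t, f t ∈ Z) :
    singularGen R f h ≫ ((singularChains R X).differential (n + 1) n).app Z =
      ∑ i : Fin (n + 2), (-1 : ℤ) ^ i.val •
        singularGen R (f.comp (simplexFace n i)) (fun _ => h _) :=
  SSet.ιChainComplex_d _ _ _

lemma singularGen_map {Z Z' : Set X} (i : Z ⟶ Z') {n : ℕ} (f : C(Simplex n, X))
    (h : ∀ t, f t ∈ Z) :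
    singularGen R f h ≫ ((singularChains R X).component n).map i =
      singularGen R f (fun t => leOfHom i (h t)) :=
  SSet.ι_chainComplexMap_f _ _ _ _ _

/-- The morphism from the singular chains with prescribed values on generators. -/
def singularDesc {Z : Set X} {n : ℕ} {A : ModuleCat.{u} R}
    (a : C(Simplex n, X) → (ModuleCat.of R R ⟶ A)) :
    ((singularChains R X).component n).obj Z ⟶ A :=
  Sigma.desc (fun s : (TopCat.toSSet.obj (TopCat.of Z)).obj
    (Opposite.op (SimplexCategory.mk n)) =>
      a ((⟨Subtype.val, continuous_subtype_val⟩ : C(Z, X)).comp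
      (TopCat.toSSetObjEquiv (TopCat.of Z) (Opposite.op (SimplexCategory.mk n)) s)))

lemma singularGen_desc {Z : Set X} {n : ℕ} {A : ModuleCat.{u} R}
    (a : C(Simplex n, X) → (ModuleCat.of R R ⟶ A)) (f : C(Simplex n, X)) (h : ∀ t, f t ∈ Z) :
    singularGen R f h ≫ singularDesc R (Z := Z) a = a f :=
  (Sigma.ι_desc _ _).trans rfl

lemma singularGen_span {Z : Set X} {n : ℕ}
    (N : Submodule R (((singularChains R X).component n).obj Z))
    (hN : ∀ f h r, singularGen R f h r ∈ N) : N = ⊤ := by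
  have : ModuleCat.ofHom N.mkQ = 0 := by
    apply singularGen_hom_ext
    intro f h
    rw [comp_zero]
    ext
    exact (Submodule.Quotient.mk_eq_zero N).2 (hN _ _ _)
  rw [eq_top_iff]
  intro x _
  exact (Submodule.Quotient.mk_eq_zero N).1 (ConcreteCategory.congr_hom this x)

end SingularSimplices

/-! ### Exactness of the columns of the double complex of singular chains -/

section Columns

variable (R : Type u) [Ring R] {X : Type u} [TopologicalSpace X] {ι : Type u} [LinearOrder ι]
  (U : ι → Set X) (q : ℕ)

/-- The condition that `σ` is a `p`-simplex of the nerve with `f` taking values in `|σ|`. -/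
structure Carries {X ι : Type u} [TopologicalSpace X] (U : ι → Set X) {q : ℕ} (p : ℕ)
    (σ : Finset ι) (f : C(Simplex q, X)) : Prop where
  card_eq : σ.card = p + 1
  mem_support : ∀ t, f t ∈ support U σ

lemma Carries.mem_nerve {X ι : Type u} [TopologicalSpace X] {U : ι → Set X} {q p : ℕ}
    {σ : Finset ι} {f : C(Simplex q, X)} (h : Carries U p σ f) :
    σ ∈ nerve U ∧ σ.card = p + 1 :=
  ⟨⟨Finset.card_pos.1 (by rw [h.card_eq]; omega), f (stdSimplex.vertex 0), h.mem_support _⟩,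
    h.card_eq⟩

open Classical in
/-- The generator of `⨁_{σ ∈ N_p} C_q(|σ|)` given by a simplex `σ` and a continuous map `f` with
values in `|σ|`; it is zero if `σ` and `f` are not of this kind. -/
def nerveGen (p : ℕ) (σ : Finset ι) (f : C(Simplex q, X)) :
    ModuleCat.of R R ⟶ nerveChainsX U ((singularChains R X).component q) p :=
  if h : Carries U p σ f then
    singularGen R f h.mem_support ≫ nerveι U ((singularChains R X).component q) ⟨σ, h.mem_nerve⟩
  else 0

lemma nerveGen_of_carries {p : ℕ} {σ : Finset ι} {f : C(Simplex q, X)} (h : Carries U p σ f) :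
    nerveGen R U q p σ f =
      singularGen R f h.mem_support ≫
        nerveι U ((singularChains R X).component q) ⟨σ, h.mem_nerve⟩ :=
  dif_pos h

lemma nerveGen_hom_ext {p : ℕ} {A : ModuleCat.{u} R}
    {a b : nerveChainsX U ((singularChains R X).component q) p ⟶ A}
    (h : ∀ σ f, Carries U p σ f → nerveGen R U q p σ f ≫ a = nerveGen R U q p σ f ≫ b) :
    a = b := by
  apply nerveChainsX_hom_ext
  intro σ
  apply singularGen_hom_ext
  intro f hf
  have hc : Carries U p σ.1 f := ⟨σ.2.2, hf⟩
  have := h σ.1 f hc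
  rw [nerveGen_of_carries R U q hc] at this
  simpa only [Category.assoc] using this

/-- Generators indexed by arbitrary finite sets let the faces be summed over `v ∈ σ`, without proofs
of membership in the nerve inside the sum. -/
lemma nerveGen_boundary {p : ℕ} {σ : Finset ι} {f : C(Simplex q, X)} (h : Carries U (p + 1) σ f) :
    nerveGen R U q (p + 1) σ f ≫ nerveBoundary U ((singularChains R X).component q) p =
      ∑ v ∈ σ, (-1 : ℤ) ^ position σ v • nerveGen R U q p (σ.erase v) f := by
  rw [nerveGen_of_carries R U q h, Category.assoc, nerveι_boundary, Preadditive.comp_sum,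
    ← Finset.sum_coe_sort σ]
  refine Finset.sum_congr rfl fun v _ => ?_
  have hc : Carries U p (σ.erase v.1) f :=
    ⟨by rw [Finset.card_erase_of_mem v.2, h.card_eq]; rfl,
      fun t => support_anti U (Finset.erase_subset _ _) (h.mem_support t)⟩
  rw [Preadditive.comp_zsmul, nerveGen_of_carries R U q hc]
  congr 1
  exact (Category.assoc _ _ _).symm.trans (congrArg (· ≫ _) (singularGen_map R _ f h.mem_support))

lemma nerveGen_augmentation {σ : Finset ι} {f : C(Simplex q, X)} (h : Carries U 0 σ f) :
    nerveGen R U q 0 σ f ≫ nerveAugmentation U ((singularChains R X).component q) =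
      singularGen R f (fun _ => Set.mem_univ _) := by
  rw [nerveGen_of_carries R U q h, Category.assoc, nerveι_augmentation]
  exact singularGen_map R _ f h.mem_support

/-- The morphism out of `⨁_{σ ∈ N_p} C_q(|σ|)` with prescribed values on generators. -/
def nerveGenDesc {p : ℕ} {A : ModuleCat.{u} R}
    (a : Finset ι → C(Simplex q, X) → (ModuleCat.of R R ⟶ A)) :
    nerveChainsX U ((singularChains R X).component q) p ⟶ A :=
  nerveDesc U (fun σ => singularDesc R (a σ.1))

lemma nerveGen_desc {p : ℕ} {A : ModuleCat.{u} R}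
    (a : Finset ι → C(Simplex q, X) → (ModuleCat.of R R ⟶ A)) {σ : Finset ι} {f : C(Simplex q, X)}
    (h : Carries U p σ f) : nerveGen R U q p σ f ≫ nerveGenDesc R U q a = a σ f := by
  rw [nerveGen_of_carries R U q h, Category.assoc, nerveGenDesc, nerveι_desc]
  exact singularGen_desc R _ f h.mem_support

/-- An index `i` with `f` taking values in `U i`, if there is any. -/
def carrier {X ι : Type u} [TopologicalSpace X] (U : ι → Set X) [Nonempty ι]
    {q : ℕ} (f : C(Simplex q, X)) : ι :=
  Classical.epsilon (fun i => ∀ t, f t ∈ U i)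

lemma mem_carrier {X ι : Type u} [TopologicalSpace X] (U : ι → Set X) [Nonempty ι]
    {q : ℕ} {f : C(Simplex q, X)} {i : ι} (h : ∀ t, f t ∈ U i) (t) :
    f t ∈ U (carrier U f) :=
  Classical.epsilon_spec (p := fun i => ∀ t, f t ∈ U i) ⟨i, h⟩ t

/-- The contracting homotopy of the columns: it adds the carrier of `f` to the simplex `σ`. -/
def columnHomotopy [Nonempty ι] (p : ℕ) :
    nerveChainsX U ((singularChains R X).component q) p ⟶
      nerveChainsX U ((singularChains R X).component q) (p + 1) :=
  nerveGenDesc R U q fun σ f => if carrier U f ∈ σ then 0 else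
    (-1 : ℤ) ^ position (insert (carrier U f) σ) (carrier U f) •
      nerveGen R U q (p + 1) (insert (carrier U f) σ) f

lemma Carries.mem_of_mem {X ι : Type u} [TopologicalSpace X] (U : ι → Set X)
    {q p : ℕ} {σ : Finset ι} {f : C(Simplex q, X)} (h : Carries U p σ f)
    {v : ι} (hv : v ∈ σ) (t) : f t ∈ U v :=
  Set.mem_iInter₂.1 (h.mem_support t) v hv

/-- Since `σ` has a vertex, `f` lies in some `U v`, so the carrier is a genuine one. The set `|σ ∪
{carrier}|` contains the image of `f`, hence is non-empty. -/
lemma Carries.insert_carrier [Nonempty ι] {q p : ℕ} {σ : Finset ι} {f : C(Simplex q, X)}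
    (h : Carries U p σ f) (hσ : carrier U f ∉ σ) :
    Carries U (p + 1) (insert (carrier U f) σ) f := by
  obtain ⟨v, hv⟩ := Finset.card_pos.1 (by rw [h.card_eq]; omega)
  refine ⟨by rw [Finset.card_insert_of_notMem hσ, h.card_eq],
    fun t => Set.mem_iInter₂.2 fun w hw => ?_⟩
  obtain rfl | hw := Finset.mem_insert.1 hw
  · exact mem_carrier U (h.mem_of_mem U hv) t
  · exact h.mem_of_mem U hw t

lemma Carries.erase {q p : ℕ} {σ : Finset ι} {f : C(Simplex q, X)} (h : Carries U (p + 1) σ f)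
    {v : ι} (hv : v ∈ σ) : Carries U p (σ.erase v) f :=
  ⟨by rw [Finset.card_erase_of_mem hv, h.card_eq]; rfl,
    fun t => support_anti U (Finset.erase_subset _ _) (h.mem_support t)⟩

lemma sign_mul_self (n : ℕ) : (-1 : ℤ) ^ n * (-1) ^ n = 1 := by
  rw [← mul_pow]; simp

lemma nerveGen_columnHomotopy_of_mem [Nonempty ι] {p : ℕ} {σ : Finset ι} {f : C(Simplex q, X)}
    (h : Carries U p σ f) (hσ : carrier U f ∈ σ) :
    nerveGen R U q p σ f ≫ columnHomotopy R U q p = 0 := by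
  rw [columnHomotopy, nerveGen_desc R U q _ h, if_pos hσ]

lemma nerveGen_columnHomotopy_of_notMem [Nonempty ι] {p : ℕ} {σ : Finset ι} {f : C(Simplex q, X)}
    (h : Carries U p σ f) (hσ : carrier U f ∉ σ) :
    nerveGen R U q p σ f ≫ columnHomotopy R U q p =
      (-1 : ℤ) ^ position (insert (carrier U f) σ) (carrier U f) •
        nerveGen R U q (p + 1) (insert (carrier U f) σ) f := by
  rw [columnHomotopy, nerveGen_desc R U q _ h, if_neg hσ]

/-- The boundary of the cone over `σ` is `σ` minus the cone over the boundary of `σ`. The sign in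
the homotopy moves the carrier to the first position. It is recorded before the homotopy is applied
to the faces, so that it serves in degree `0` too. -/
lemma nerveGen_columnHomotopy_boundary [Nonempty ι] {p : ℕ} {σ : Finset ι} {f : C(Simplex q, X)}
    (h : Carries U p σ f) (hσ : carrier U f ∉ σ) :
    nerveGen R U q p σ f ≫ columnHomotopy R U q p ≫
        nerveBoundary U ((singularChains R X).component q) p =
      nerveGen R U q p σ f -
        ∑ v ∈ σ, ((-1 : ℤ) ^ position σ v *
          (-1) ^ position (insert (carrier U f) (σ.erase v)) (carrier U f)) •
          nerveGen R U q p (insert (carrier U f) (σ.erase v)) f := by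
  set i := carrier U f with hi
  rw [← Category.assoc, nerveGen_columnHomotopy_of_notMem R U q h hσ, Preadditive.zsmul_comp,
    nerveGen_boundary R U q (h.insert_carrier U hσ), Finset.sum_insert hσ, smul_add, smul_smul,
    sign_mul_self, one_smul, Finset.erase_insert hσ, sub_eq_add_neg, Finset.smul_sum,
    ← Finset.sum_neg_distrib]
  congr 1
  refine Finset.sum_congr rfl fun v hv => ?_
  have hvi : v ≠ i := fun e => hσ (e ▸ hv)
  have he : (insert i σ).erase v = insert i (σ.erase v) := Finset.erase_insert_of_ne hvi.symm
  have hs := sign_swap (σ := insert i σ) (Finset.mem_insert_of_mem hv)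
    (Finset.mem_insert_self i σ) hvi
  rw [Finset.erase_insert hσ, he] at hs
  have h1 : (-1 : ℤ) ^ position (insert i σ) i * (-1) ^ position (insert i σ) v =
      -((-1) ^ position σ v * (-1) ^ position (insert i (σ.erase v)) i) := by
    have ha := sign_mul_self (position (insert i (σ.erase v)) i)
    have hb := sign_mul_self (position (insert i σ) i)
    -- This is `hs` multiplied by the signs of `i` in `insert i σ` and in `insert i (σ.erase v)`,
    -- whose squares are `1`.
    linear_combination (-(-1 : ℤ) ^ position (insert i σ) i * (-1) ^ position (insert i σ) v) * ha +
      ((-1 : ℤ) ^ position (insert i σ) i * (-1) ^ position (insert i (σ.erase v)) i) * hs -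
      ((-1 : ℤ) ^ position (insert i (σ.erase v)) i * (-1) ^ position σ v) * hb
  rw [← hi, he, smul_smul, h1, neg_smul]

/-- The carrier depends on `f` alone, so it is unchanged when passing to faces of `σ`. If it is
already a vertex of `σ`, only the face opposite to it contributes, and its cone is `σ`. -/
lemma columnHomotopy_spec [Nonempty ι] (p : ℕ) :
    columnHomotopy R U q (p + 1) ≫ nerveBoundary U ((singularChains R X).component q) (p + 1) +
      nerveBoundary U ((singularChains R X).component q) p ≫ columnHomotopy R U q p = 𝟙 _ := by
  apply nerveGen_hom_ext
  intro σ f h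
  rw [Preadditive.comp_add, Category.comp_id, ← Category.assoc _ (nerveBoundary U _ p),
    nerveGen_boundary R U q h, Preadditive.sum_comp]
  simp only [Preadditive.zsmul_comp]
  by_cases hσ : carrier U f ∈ σ
  · rw [← Category.assoc, nerveGen_columnHomotopy_of_mem R U q h hσ, zero_comp, zero_add,
      Finset.sum_eq_single_of_mem _ hσ, nerveGen_columnHomotopy_of_notMem R U q (h.erase U hσ)
        (Finset.notMem_erase _ _), Finset.insert_erase hσ, smul_smul, sign_mul_self, one_smul]
    intro v hv hne
    rw [nerveGen_columnHomotopy_of_mem R U q (h.erase U hv)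
      (Finset.mem_erase.2 ⟨hne.symm, hσ⟩), smul_zero]
  · rw [nerveGen_columnHomotopy_boundary R U q h hσ, sub_add_eq_add_sub, sub_eq_iff_eq_add]
    congr 1
    refine Finset.sum_congr rfl fun v hv => ?_
    rw [nerveGen_columnHomotopy_of_notMem R U q (h.erase U hv)
      (fun hm => hσ (Finset.mem_of_mem_erase hm)), smul_smul]

/-- The contracting homotopy of the columns in degree `-1`. -/
def columnHomotopyAug [Nonempty ι] :
    ((singularChains R X).component q).obj Set.univ ⟶
      nerveChainsX U ((singularChains R X).component q) 0 :=
  singularDesc R fun f => nerveGen R U q 0 {carrier U f} f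

/-- In degree `0` the cone over the empty face is the carrier itself, which the augmentation term
supplies. -/
lemma columnHomotopyAug_spec [Nonempty ι] :
    columnHomotopy R U q 0 ≫ nerveBoundary U ((singularChains R X).component q) 0 +
      nerveAugmentation U ((singularChains R X).component q) ≫ columnHomotopyAug R U q = 𝟙 _ := by
  apply nerveGen_hom_ext
  intro σ f h
  rw [Preadditive.comp_add, Category.comp_id, ← Category.assoc _ (nerveAugmentation U _),
    nerveGen_augmentation R U q h, columnHomotopyAug, singularGen_desc R _ f]
  obtain ⟨v, rfl⟩ := Finset.card_eq_one.1 h.card_eq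
  by_cases hσ : carrier U f ∈ ({v} : Finset ι)
  · rw [← Category.assoc, nerveGen_columnHomotopy_of_mem R U q h hσ, zero_comp, zero_add,
      Finset.mem_singleton.1 hσ]
  · rw [nerveGen_columnHomotopy_boundary R U q h hσ, Finset.sum_singleton,
      Finset.erase_singleton]
    simp [position, Finset.filter_singleton]

/-- The columns of the double complex of singular chains are exact in positive degrees. -/
lemma nerveBoundary_exact (p : ℕ) (x : nerveChainsX U ((singularChains R X).component q) (p + 1))
    (hx : nerveBoundary U ((singularChains R X).component q) p x = 0) :
    ∃ y, nerveBoundary U ((singularChains R X).component q) (p + 1) y = x := by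
  -- Without indices there is no carrier, but then the nerve has no simplices either.
  cases isEmpty_or_nonempty ι
  · have : x = 0 := DFinsupp.ext fun σ => by
      have := σ.2.2
      rw [Finset.eq_empty_of_isEmpty σ.1] at this
      simp at this
    exact ⟨0, by rw [map_zero, this]⟩
  · refine ⟨columnHomotopy R U q (p + 1) x, ?_⟩
    have := ConcreteCategory.congr_hom (columnHomotopy_spec R U q p) x
    change nerveBoundary U _ (p + 1) (columnHomotopy R U q (p + 1) x) +
      columnHomotopy R U q p (nerveBoundary U _ p x) = x at this
    rwa [hx, map_zero, add_zero] at this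

lemma nerveAugmentation_exact (x : nerveChainsX U ((singularChains R X).component q) 0)
    (hx : nerveAugmentation U ((singularChains R X).component q) x = 0) :
    ∃ y, nerveBoundary U ((singularChains R X).component q) 0 y = x := by
  cases isEmpty_or_nonempty ι
  · have : x = 0 := DFinsupp.ext fun σ => by
      have := σ.2.2
      rw [Finset.eq_empty_of_isEmpty σ.1] at this
      simp at this
    exact ⟨0, by rw [map_zero, this]⟩
  · refine ⟨columnHomotopy R U q 0 x, ?_⟩
    have := ConcreteCategory.congr_hom (columnHomotopyAug_spec R U q) x
    change nerveBoundary U _ 0 (columnHomotopy R U q 0 x) +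
      columnHomotopyAug R U q (nerveAugmentation U _ x) = x at this
    rwa [hx, map_zero, add_zero] at this

end Columns

/-! ### Formal combinations of affine maps between simplices -/

section Affine

/-- An affine map from the `m`-simplex to the `n`-simplex, as a row-stochastic matrix: its rows are
the images of the vertices. -/
@[ext]
structure AffineMatrix (n m : ℕ) where
  mat : Matrix (Fin (m + 1)) (Fin (n + 1)) ℝ
  nonneg : ∀ i j, 0 ≤ mat i j
  sum_eq_one : ∀ i, ∑ j, mat i j = 1

namespace AffineMatrix

variable {n m k : ℕ}

lemma mulVec_one (G : AffineMatrix n m) : G.mat.mulVec 1 = 1 := by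
  ext i
  simp [Matrix.mulVec, dotProduct, G.sum_eq_one]

/-- The composition of affine maps. -/
def comp (G : AffineMatrix n m) (H : AffineMatrix m k) : AffineMatrix n k where
  mat := H.mat * G.mat
  nonneg i j := by
    rw [Matrix.mul_apply]
    exact Finset.sum_nonneg fun k _ => mul_nonneg (H.nonneg i k) (G.nonneg k j)
  sum_eq_one i := by
    have : (H.mat * G.mat).mulVec 1 i = 1 := by
      rw [← Matrix.mulVec_mulVec, G.mulVec_one, H.mulVec_one]; rfl
    simpa [Matrix.mulVec, dotProduct] using this

/-- The affine map given by a map on vertices. -/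
def ofVertices (f : Fin (m + 1) → Fin (n + 1)) : AffineMatrix n m where
  mat := (1 : Matrix (Fin (n + 1)) (Fin (n + 1)) ℝ).submatrix f id
  nonneg i j := by rw [Matrix.submatrix_apply, Matrix.one_apply]; positivity
  sum_eq_one i := by simp [Matrix.one_apply]

lemma comp_ofVertices_mat (G : AffineMatrix k n) (f : Fin (m + 1) → Fin (n + 1)) :
    (G.comp (ofVertices f)).mat = G.mat.submatrix f id := by
  ext i j
  simp [comp, ofVertices, Matrix.mul_apply, Matrix.one_apply]

/-- The cone of an affine map, with vertex the barycenter. -/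
def cone (G : AffineMatrix n m) : AffineMatrix n (m + 1) where
  mat i j := Fin.cases ((n : ℝ) + 1)⁻¹ (fun i => G.mat i j) i
  nonneg i j := by
    refine Fin.cases ?_ (fun i => ?_) i
    · change 0 ≤ ((n : ℝ) + 1)⁻¹
      positivity
    · exact G.nonneg i j
  sum_eq_one i := by
    refine Fin.cases ?_ (fun i => ?_) i
    · change ∑ j : Fin (n + 1), ((n : ℝ) + 1)⁻¹ = 1
      rw [Finset.sum_const, Finset.card_univ, Fintype.card_fin, nsmul_eq_mul]
      push_cast
      field_simp
    · exact G.sum_eq_one i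

lemma cone_face_zero (G : AffineMatrix n m) :
    G.cone.comp (ofVertices (Fin.succAbove 0)) = G := by
  ext i j
  rw [comp_ofVertices_mat, Matrix.submatrix_apply, Fin.succAbove_zero]
  rfl

/-- The barycenter is vertex `0` of the cone, so omitting a later vertex omits a vertex of the base.
-/
lemma cone_face_succ (G : AffineMatrix n (m + 1)) (i : Fin (m + 2)) :
    G.cone.comp (ofVertices (Fin.succAbove i.succ)) =
      (G.comp (ofVertices (Fin.succAbove i))).cone := by
  ext k j
  rw [comp_ofVertices_mat, Matrix.submatrix_apply]
  refine Fin.cases ?_ (fun k => ?_) k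
  · rw [Fin.succ_succAbove_zero]; rfl
  · rw [Fin.succ_succAbove_succ]
    change G.mat _ _ = (G.comp (ofVertices (Fin.succAbove i))).mat k j
    rw [comp_ofVertices_mat]
    rfl

end AffineMatrix

/-- The category whose objects are natural numbers and whose morphisms from `n` to `m` are the
affine maps from the `m`-simplex to the `n`-simplex. -/
structure AffineSimplex where
  len : ℕ

/-- Points are row vectors, so composition is the matrix product in reverse order. With arrows in
this direction, a morphism `n ⟶ m` acts covariantly from `n`-chains to `m`-chains by precomposition.
-/
instance : Category AffineSimplex where
  Hom n m := AffineMatrix n.len m.len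
  id n := ⟨1, fun i j => by rw [Matrix.one_apply]; positivity, fun i => by simp [Matrix.one_apply]⟩
  comp G H := G.comp H
  id_comp G := AffineMatrix.ext (Matrix.mul_one _)
  comp_id G := AffineMatrix.ext (Matrix.one_mul _)
  assoc G H K := AffineMatrix.ext (Matrix.mul_assoc _ _ _).symm

/-- The simplicial object of `AffineSimplex` given by the standard simplices. -/
def affineSimplicial : SimplexCategoryᵒᵖ ⥤ AffineSimplex where
  obj n := ⟨n.unop.len⟩
  map f := AffineMatrix.ofVertices f.unop.toOrderHom
  map_id _ := AffineMatrix.ext rfl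
  map_comp f g := AffineMatrix.ext (AffineMatrix.comp_ofVertices_mat
    (AffineMatrix.ofVertices f.unop.toOrderHom) g.unop.toOrderHom).symm

/-- The object of the category of formal combinations of affine maps given by a natural number. -/
abbrev chainOf (n : ℕ) : Free ℤ AffineSimplex := Free.of ℤ ⟨n⟩

/-- An affine map as a formal combination. -/
def affineSingle {n m : ℕ} (G : AffineMatrix n m) : chainOf n ⟶ chainOf m :=
  (Free.embedding ℤ AffineSimplex).map (X := ⟨n⟩) (Y := ⟨m⟩) G

lemma affineSingle_comp {n m k : ℕ} (G : AffineMatrix n m) (H : AffineMatrix m k) :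
    affineSingle (G.comp H) = affineSingle G ≫ affineSingle H :=
  (Free.embedding ℤ AffineSimplex).map_comp (X := ⟨n⟩) (Y := ⟨m⟩) (Z := ⟨k⟩) G H

/-- Morphisms of the `ℤ`-linear free category are finitely supported integer functions on affine
maps, so sums and negatives of single maps exhaust them. -/
lemma affine_induction {n m : ℕ} {p : (chainOf n ⟶ chainOf m) → Prop}
    (c : chainOf n ⟶ chainOf m) (h1 : ∀ G, p (affineSingle G))
    (hadd : ∀ c c', p c → p c' → p (c + c')) (hneg : ∀ c, p c → p (-c)) (h0 : p 0) : p c := by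
  have hn : ∀ c : chainOf n ⟶ chainOf m, p c → ∀ k : ℕ, p (k • c) := fun c hc k => by
    induction k with
    | zero => rw [zero_smul]; exact h0
    | succ k ih => rw [succ_nsmul]; exact hadd _ _ ih hc
  have hz : ∀ c : chainOf n ⟶ chainOf m, p c → ∀ k : ℤ, p (k • c) := fun c hc k => by
    obtain ⟨k, rfl | rfl⟩ := k.eq_nat_or_neg
    · rw [natCast_zsmul]; exact hn c hc k
    · rw [neg_smul, natCast_zsmul]; exact hneg _ (hn c hc k)
  refine Finsupp.induction_linear (motive := p) c h0 hadd fun G r => ?_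
  have := hz (affineSingle G) (h1 G) r
  convert this
  change _ = r • Finsupp.single G (1 : ℤ)
  rw [Finsupp.smul_single, smul_eq_mul, mul_one]

/-- The boundary, as a formal combination of affine maps. -/
def affineBoundary (n : ℕ) : chainOf (n + 1) ⟶ chainOf n :=
  ∑ i : Fin (n + 2), (-1 : ℤ) ^ i.val • affineSingle (AffineMatrix.ofVertices (Fin.succAbove i))

/-- The standard simplices form a simplicial object, and this is `d² = 0` in its alternating face
map complex. -/
lemma affineBoundary_comp (n : ℕ) : affineBoundary (n + 1) ≫ affineBoundary n = 0 :=
  AlgebraicTopology.AlternatingFaceMapComplex.d_squared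
    (affineSimplicial ⋙ Free.embedding ℤ AffineSimplex) n

/-- The cone of a formal combination of affine maps. -/
def affineCone {n m : ℕ} : (chainOf n ⟶ chainOf m) →+ (chainOf n ⟶ chainOf (m + 1)) :=
  Finsupp.mapDomain.addMonoidHom AffineMatrix.cone

lemma affineCone_single {n m : ℕ} (G : AffineMatrix n m) :
    affineCone (affineSingle G) = affineSingle G.cone :=
  Finsupp.mapDomain_single

/-- Face `0` of a cone is the base and the other faces are cones over faces of the base, with sign
shifted by one. The base has dimension at least `1`, so no augmentation term appears. -/
lemma affineCone_boundary {n m : ℕ} (c : chainOf n ⟶ chainOf (m + 1)) :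
    affineCone c ≫ affineBoundary (m + 1) = c - affineCone (c ≫ affineBoundary m) := by
  refine affine_induction (p := fun c => affineCone c ≫ affineBoundary (m + 1) =
    c - affineCone (c ≫ affineBoundary m)) c (fun G => ?_) (fun c c' h h' => ?_) (fun c h => ?_) ?_
  · rw [affineCone_single, affineBoundary, affineBoundary, Preadditive.comp_sum,
      Preadditive.comp_sum, map_sum, Fin.sum_univ_succ, sub_eq_add_neg, ← Finset.sum_neg_distrib]
    congr 1
    · rw [Fin.val_zero, pow_zero, one_smul, ← affineSingle_comp, AffineMatrix.cone_face_zero]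
    · refine Finset.sum_congr rfl fun i _ => ?_
      rw [Preadditive.comp_zsmul, Preadditive.comp_zsmul, map_zsmul, ← affineSingle_comp,
        ← affineSingle_comp, affineCone_single, AffineMatrix.cone_face_succ, Fin.val_succ, pow_succ,
        mul_neg_one, neg_smul]
  · rw [map_add, Preadditive.add_comp, Preadditive.add_comp, map_add, h, h']
    abel
  · rw [map_neg, Preadditive.neg_comp, Preadditive.neg_comp, map_neg, h]
    abel
  · rw [map_zero, zero_comp, zero_comp, map_zero, sub_zero]

/-- The homotopy between the identity and the barycentric subdivision. -/
def subdivisionHomotopy : ∀ n : ℕ, chainOf n ⟶ chainOf (n + 1)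
  | 0 => 0
  | n + 1 => affineCone (𝟙 _ - affineBoundary n ≫ subdivisionHomotopy n)

/-- The barycentric subdivision. -/
def subdivision : ∀ n : ℕ, chainOf n ⟶ chainOf n
  | 0 => 𝟙 _
  | n + 1 => affineCone (affineBoundary n ≫ subdivision n)

/-- The homotopy formula `S = 1 - dT - Td`, with composites written in diagrammatic order. -/
lemma subdivision_succ (n : ℕ) :
    subdivision (n + 1) = 𝟙 _ - subdivisionHomotopy (n + 1) ≫ affineBoundary (n + 1) -
      affineBoundary n ≫ subdivisionHomotopy n := by
  -- The cone formula reduces the claim to the formula one degree lower, after composing with the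
  -- boundary. There the term `Td` drops out by `d² = 0`.
  have h : ∀ n, affineBoundary n ≫ subdivision n =
      affineBoundary n ≫ (𝟙 _ - subdivisionHomotopy n ≫ affineBoundary n) →
      subdivision (n + 1) = 𝟙 _ - subdivisionHomotopy (n + 1) ≫ affineBoundary (n + 1) -
        affineBoundary n ≫ subdivisionHomotopy n := by
    intro n hn
    rw [subdivision, subdivisionHomotopy, affineCone_boundary, hn, Preadditive.sub_comp,
      Category.id_comp, Preadditive.comp_sub, Category.comp_id, Category.assoc]
    abel
  induction n with
  | zero => exact h 0 (by rw [subdivision, subdivisionHomotopy, zero_comp, sub_zero])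
  | succ n ih =>
    apply h
    rw [ih, Preadditive.comp_sub _ (𝟙 _ - _), ← Category.assoc _ (affineBoundary n),
      affineBoundary_comp, zero_comp, sub_zero]

end Affine

/-! ### Subdivision is contracting -/

section Contraction

/-- The affine map `G` multiplies the oscillation of affine functions by at most `c`. -/
def Contracts {n m : ℕ} (G : AffineMatrix n m) (c : ℝ) : Prop :=
  ∀ (w : Fin (n + 1) → ℝ) (D : ℝ), (∀ i j, w i - w j ≤ D) →
    ∀ i j, G.mat.mulVec w i - G.mat.mulVec w j ≤ c * D

lemma Contracts.comp {n m k : ℕ} {G : AffineMatrix n m} {H : AffineMatrix m k}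
    {c c' : ℝ} (hG : Contracts G c) (hH : Contracts H c') : Contracts (G.comp H) (c' * c) := by
  intro w D hw i j
  have := hH _ _ (hG w D hw) i j
  simp only [Matrix.mulVec_mulVec] at this
  rw [mul_assoc]
  exact this

/-- The identity of the `n`-simplex. -/
abbrev affineId (n : ℕ) : AffineMatrix n n := 𝟙 (⟨n⟩ : AffineSimplex)

lemma contracts_id (n : ℕ) : Contracts (affineId n) 1 := by
  intro w D hw i j
  change (1 : Matrix (Fin (n + 1)) (Fin (n + 1)) ℝ).mulVec w i -
    (1 : Matrix (Fin (n + 1)) (Fin (n + 1)) ℝ).mulVec w j ≤ _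
  rw [Matrix.one_mulVec, one_mul]
  exact hw i j

lemma contracts_id_zero : Contracts (affineId 0) 0 := by
  intro w D hw i j
  rw [Subsingleton.elim (α := Fin 1) i j, sub_self, zero_mul]

/-- The left side is the mean of `n + 1` differences `w i - w k`, one of which is zero and the
others at most `D`. -/
lemma barycenter_sub_le {n : ℕ} (w : Fin (n + 1) → ℝ) (D : ℝ) (hw : ∀ i j, w i - w j ≤ D)
    (k : Fin (n + 1)) : ∑ i, ((n : ℝ) + 1)⁻¹ * w i - w k ≤ n / (n + 1) * D := by
  have h1 : ∑ i, (w i - w k) ≤ n * D := by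
    rw [← Finset.sum_erase_add _ _ (Finset.mem_univ k), sub_self, add_zero]
    refine (Finset.sum_le_card_nsmul _ _ D fun i _ => hw i k).trans (le_of_eq ?_)
    rw [Finset.card_erase_of_mem (Finset.mem_univ k), Finset.card_univ, Fintype.card_fin,
      nsmul_eq_mul, Nat.add_sub_cancel]
  rw [Finset.sum_sub_distrib, Finset.sum_const, Finset.card_univ, Fintype.card_fin,
    nsmul_eq_mul] at h1
  rw [← Finset.mul_sum]
  push_cast at h1
  have h2 : (0 : ℝ) < n + 1 := by positivity
  have h3 : ((n : ℝ) + 1)⁻¹ * ∑ i, w i - w k =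
      ((n : ℝ) + 1)⁻¹ * (∑ i, w i - (n + 1) * w k) := by field_simp
  have h4 : (n : ℝ) / (n + 1) * D = ((n : ℝ) + 1)⁻¹ * (n * D) := by field_simp
  rw [h3, h4]
  exact mul_le_mul_of_nonneg_left h1 (by positivity)

/-- A value of an affine function at a point is a convex combination of its values at the vertices.
-/
lemma sub_mulVec_le {n m : ℕ} (G : AffineMatrix n m) (w : Fin (n + 1) → ℝ) (a b : ℝ)
    (h : ∀ k, a - w k ≤ b) (i : Fin (m + 1)) : a - G.mat.mulVec w i ≤ b := by
  have h1 : ∑ k, G.mat i k * (a - w k) ≤ ∑ k, G.mat i k * b :=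
    Finset.sum_le_sum fun k _ => mul_le_mul_of_nonneg_left (h k) (G.nonneg i k)
  simp only [mul_sub, Finset.sum_sub_distrib, ← Finset.sum_mul,
    G.sum_eq_one i, one_mul] at h1
  exact h1

lemma mulVec_sub_le {n m : ℕ} (G : AffineMatrix n m) (w : Fin (n + 1) → ℝ) (a b : ℝ)
    (h : ∀ k, w k - a ≤ b) (i : Fin (m + 1)) : G.mat.mulVec w i - a ≤ b := by
  have := sub_mulVec_le G (-w) (-a) b (fun k => by simpa [add_comm, sub_eq_add_neg] using h k) i
  rw [Matrix.mulVec_neg, Pi.neg_apply] at this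
  linarith

/-- Only pairs of vertices matter. A pair involving the barycenter is bounded by
`barycenter_sub_le`, a pair in the base by `hG` and `hc`. -/
lemma Contracts.cone {n m : ℕ} {G : AffineMatrix n m} {c : ℝ} (hG : Contracts G c)
    (hc : c ≤ n / (n + 1)) : Contracts G.cone (n / (n + 1)) := by
  intro w D hw i j
  have hD : 0 ≤ D := by simpa using hw 0 0
  have h0 : G.cone.mat.mulVec w 0 = ∑ i, ((n : ℝ) + 1)⁻¹ * w i := rfl
  have hs : ∀ i, G.cone.mat.mulVec w (Fin.succ i) =
    G.mat.mulVec w i := fun i => rfl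
  have hb := barycenter_sub_le w D hw
  have hb' : ∀ k, w k - ∑ i, ((n : ℝ) + 1)⁻¹ * w i ≤ n / (n + 1) * D := fun k => by
    have := barycenter_sub_le (-w) D
      (fun i j => by simpa [add_comm, sub_eq_add_neg] using hw j i) k
    simp only [Pi.neg_apply, mul_neg, Finset.sum_neg_distrib] at this
    linarith
  refine Fin.cases ?_ (fun i => ?_) i <;> refine Fin.cases ?_ (fun j => ?_) j
  · rw [sub_self]; positivity
  · rw [h0, hs]; exact sub_mulVec_le G w _ _ hb j
  · rw [h0, hs]; exact mulVec_sub_le G w _ _ hb' i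
  · rw [hs, hs]
    exact (hG w D hw i j).trans (mul_le_mul_of_nonneg_right hc hD)

lemma contracts_AffineMatrix.ofVertices {n m : ℕ} (f : Fin (m + 1) → Fin (n + 1)) :
    Contracts (AffineMatrix.ofVertices f) 1 := by
  intro w D hw i j
  have : ∀ i, (AffineMatrix.ofVertices f).mat.mulVec w i = w (f i) := fun i => by
    simp [AffineMatrix.ofVertices, Matrix.mulVec, dotProduct, Matrix.one_apply]
  rw [this, this, one_mul]
  exact hw _ _

/-- The formal combinations of affine maps contracting by the factor `c`. -/
def contracting (n m : ℕ) (c : ℝ) : AddSubgroup (chainOf n ⟶ chainOf m) :=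
  AddSubgroup.closure {x | ∃ G, Contracts G c ∧ affineSingle G = x}

lemma single_mem_contracting {n m : ℕ} {G : AffineMatrix n m} {c : ℝ}
    (h : Contracts G c) : affineSingle G ∈ contracting n m c :=
  AddSubgroup.subset_closure ⟨G, h, rfl⟩

lemma contracting_le {n m : ℕ} {c : ℝ} {N : AddSubgroup (chainOf n ⟶ chainOf m)}
    (h : ∀ G, Contracts G c → affineSingle G ∈ N) : contracting n m c ≤ N := by
  rw [contracting, AddSubgroup.closure_le]
  rintro _ ⟨G, hG, rfl⟩
  exact h G hG

lemma comp_mem_contracting {n m k : ℕ} {c c' : ℝ} {x : chainOf n ⟶ chainOf m}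
    {y : chainOf m ⟶ chainOf k} (hx : x ∈ contracting n m c) (hy : y ∈ contracting m k c') :
    x ≫ y ∈ contracting n k (c' * c) := by
  suffices contracting n m c ≤ (contracting n k (c' * c)).comap (Preadditive.rightComp _ y) from
    this hx
  refine contracting_le fun G hG => ?_
  suffices contracting m k c' ≤ (contracting n k (c' * c)).comap
    (Preadditive.leftComp _ (affineSingle G)) from this hy
  refine contracting_le fun H hH => ?_
  change affineSingle G ≫ affineSingle H ∈ contracting n k (c' * c)
  rw [← affineSingle_comp]
  exact single_mem_contracting (hG.comp hH)

lemma affineBoundary_mem_contracting (n : ℕ) : affineBoundary n ∈ contracting (n + 1) n 1 :=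
  sum_mem fun _ _ => zsmul_mem (single_mem_contracting (contracts_AffineMatrix.ofVertices _)) _

/-- Faces do not expand, so by induction the base of each cone has factor `n / (n + 1) ≤ (n + 1) /
(n + 2)`, which is what `Contracts.cone` requires. In degree `0` a point has oscillation `0`. -/
lemma subdivision_mem_contracting (n : ℕ) :
    subdivision n ∈ contracting n n ((n : ℝ) / (n + 1)) := by
  induction n with
  | zero =>
    have := single_mem_contracting contracts_id_zero
    rw [Nat.cast_zero, zero_div]
    exact this
  | succ n ih =>
    have h1 := comp_mem_contracting (affineBoundary_mem_contracting n) ih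
    rw [mul_one] at h1
    suffices contracting (n + 1) n ((n : ℝ) / (n + 1)) ≤
      (contracting (n + 1) (n + 1) (((n + 1 : ℕ) : ℝ) / ((n + 1 : ℕ) + 1))).comap affineCone from
      this h1
    refine contracting_le fun G hG => ?_
    rw [AddSubgroup.mem_comap, affineCone_single]
    refine single_mem_contracting (hG.cone ?_)
    push_cast
    rw [div_le_div_iff₀ (by positivity) (by positivity)]
    nlinarith

end Contraction

/-! ### The action of formal combinations of affine maps on singular chains -/

section Action

/-- The continuous map between standard simplices given by a row-stochastic matrix. -/
def AffineMatrix.toMap {n m : ℕ} (G : AffineMatrix n m) : C(Simplex m, Simplex n) where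
  toFun t := ⟨Matrix.vecMul t.1 G.mat, fun j => by
      rw [Matrix.vecMul, dotProduct]
      exact Finset.sum_nonneg fun i _ => mul_nonneg (t.2.1 i) (G.nonneg i j), by
      simp only [Matrix.vecMul, dotProduct]
      rw [Finset.sum_comm]
      simp only [← Finset.mul_sum, G.sum_eq_one, mul_one]
      exact t.2.2⟩
  continuous_toFun := by
    refine Continuous.subtype_mk ?_ _
    exact continuous_subtype_val.matrix_vecMul continuous_const

lemma AffineMatrix.toMap_comp {n m k : ℕ} (G : AffineMatrix n m) (H : AffineMatrix m k) :
    (G.comp H).toMap = G.toMap.comp H.toMap := by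
  ext t : 2
  exact (Matrix.vecMul_vecMul t.1 H.mat G.mat).symm

lemma affineId_toMap (n : ℕ) : (affineId n).toMap = ContinuousMap.id _ := by
  ext t : 2
  exact Matrix.vecMul_one t.1

lemma ofVertices_toMap {n : ℕ} (i : Fin (n + 2)) :
    (AffineMatrix.ofVertices (Fin.succAbove i)).toMap = simplexFace n i := by
  ext t j
  refine Eq.trans ?_ (FunOnFinite.linearMap_apply_apply ℝ ℝ i.succAbove t.1 j).symm
  change ∑ k, t.1 k * (1 : Matrix (Fin (n + 2)) (Fin (n + 2)) ℝ) (i.succAbove k) j = _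
  simp only [Matrix.one_apply, mul_ite, mul_one, mul_zero, Finset.sum_filter]

variable (R : Type u) [Ring R] {X : Type u} [TopologicalSpace X]

variable (X) in
/-- The singular chains of `X`. -/
abbrev chainsOf (n : ℕ) : ModuleCat.{u} R := ((singularChains R X).component n).obj Set.univ

/-- The generator of the singular chains of `X` given by a singular simplex. -/
abbrev univGen {n : ℕ} (f : C(Simplex n, X)) : ModuleCat.of R R ⟶ chainsOf R X n :=
  singularGen R f (fun _ => Set.mem_univ _)

variable (X) in
/-- The map of singular chains given by an affine map. -/
def affineAct {n m : ℕ} (G : AffineMatrix n m) : chainsOf R X n ⟶ chainsOf R X m :=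
  singularDesc R fun f => univGen R (f.comp G.toMap)

lemma univGen_affineAct {n m : ℕ} (f : C(Simplex n, X)) (G : AffineMatrix n m) :
    univGen R f ≫ affineAct R X G = univGen R (f.comp G.toMap) :=
  singularGen_desc R _ f _

lemma affineAct_comp {n m k : ℕ} (G : AffineMatrix n m) (H : AffineMatrix m k) :
    affineAct R X (G.comp H) = affineAct R X G ≫ affineAct R X H := by
  apply singularGen_hom_ext
  intro f _
  rw [← Category.assoc, univGen_affineAct, univGen_affineAct, univGen_affineAct,
    AffineMatrix.toMap_comp, ContinuousMap.comp_assoc]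

variable (X) in
/-- The map of singular chains given by a formal combination of affine maps. -/
def chainAct (n m : ℕ) : (chainOf n ⟶ chainOf m) →+ (chainsOf R X n ⟶ chainsOf R X m) :=
  Finsupp.liftAddHom fun G => zmultiplesHom _ (affineAct R X G)

lemma chainAct_single {n m : ℕ} (G : AffineMatrix n m) :
    chainAct R X n m (affineSingle G) = affineAct R X G :=
  (Finsupp.liftAddHom_apply_single _ _ _).trans (one_smul _ _)

lemma chainAct_id (n : ℕ) : chainAct R X n n (𝟙 _) = 𝟙 _ := by
  refine (chainAct_single R (affineId n)).trans ?_
  apply singularGen_hom_ext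
  intro f _
  rw [univGen_affineAct, affineId_toMap, ContinuousMap.comp_id, Category.comp_id]

/-- With `chainAct_id` and `chainAct_boundary`, this transfers identities between formal
combinations to singular chains. -/
lemma chainAct_comp {n m k : ℕ} (c : chainOf n ⟶ chainOf m) (c' : chainOf m ⟶ chainOf k) :
    chainAct R X n k (c ≫ c') = chainAct R X n m c ≫ chainAct R X m k c' := by
  refine affine_induction (p := fun c => chainAct R X n k (c ≫ c') =
    chainAct R X n m c ≫ chainAct R X m k c') c (fun G => ?_) (fun a b ha hb => ?_)
    (fun a ha => ?_) ?_
  · refine affine_induction (p := fun c' => chainAct R X n k (affineSingle G ≫ c') =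
      chainAct R X n m (affineSingle G) ≫ chainAct R X m k c') c' (fun H => ?_)
      (fun a b ha hb => ?_) (fun a ha => ?_) ?_
    · rw [← affineSingle_comp, chainAct_single, chainAct_single, chainAct_single, affineAct_comp]
    · rw [Preadditive.comp_add, map_add, map_add, ha, hb, Preadditive.comp_add]
    · rw [Preadditive.comp_neg, map_neg, map_neg, ha, Preadditive.comp_neg]
    · rw [comp_zero, map_zero, map_zero, comp_zero]
  · rw [Preadditive.add_comp, map_add, map_add, ha, hb, Preadditive.add_comp]
  · rw [Preadditive.neg_comp, map_neg, map_neg, ha, Preadditive.neg_comp]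
  · rw [zero_comp, map_zero, map_zero, zero_comp]

lemma chainAct_boundary (n : ℕ) : chainAct R X (n + 1) n (affineBoundary n) =
    ((singularChains R X).differential (n + 1) n).app Set.univ := by
  apply singularGen_hom_ext
  intro f h
  rw [singularGen_d, affineBoundary, map_sum, Preadditive.comp_sum]
  refine Finset.sum_congr rfl fun i _ => ?_
  rw [map_zsmul, Preadditive.comp_zsmul, chainAct_single, univGen_affineAct, ofVertices_toMap]

end Action

/-! ### Small chains -/

section Small

variable (R : Type u) [Ring R] {X : Type u} [TopologicalSpace X] {ι : Type u} (U : ι → Set X)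

/-- The singular chains of `X` that are combinations of simplices contained in members of `U`. -/
def smallChains (n : ℕ) : Submodule R (chainsOf R X n) :=
  Submodule.span R {a | ∃ f : C(Simplex n, X), (∃ i, ∀ t, f t ∈ U i) ∧ ∃ r, univGen R f r = a}

variable {U} in
lemma univGen_mem_smallChains {n : ℕ} {f : C(Simplex n, X)} {i : ι} (h : ∀ t, f t ∈ U i) (r : R) :
    univGen R f r ∈ smallChains R U n :=
  Submodule.subset_span ⟨f, ⟨i, h⟩, r, rfl⟩

/-- The morphisms of singular chains with a given property of the images of an element form an
additive group. -/
def homsInto {A B : ModuleCat.{u} R} (a : A) (N : Submodule R B) : AddSubgroup (A ⟶ B) where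
  carrier := {g | g a ∈ N}
  add_mem' h h' := N.add_mem h h'
  zero_mem' := N.zero_mem
  neg_mem' h := N.neg_mem h

lemma chainAct_mem_smallChains {n m : ℕ} (c : chainOf n ⟶ chainOf m) {a : chainsOf R X n}
    (ha : a ∈ smallChains R U n) : chainAct R X n m c a ∈ smallChains R U m := by
  suffices smallChains R U n ≤ (smallChains R U m).comap (chainAct R X n m c).hom from this ha
  refine Submodule.span_le.2 ?_
  rintro _ ⟨f, ⟨i, hi⟩, r, rfl⟩
  change c ∈ (homsInto R (univGen R f r) (smallChains R U m)).comap (chainAct R X n m)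
  refine affine_induction (p := fun c => c ∈ (homsInto R (univGen R f r)
    (smallChains R U m)).comap (chainAct R X n m)) c (fun G => ?_)
    (fun _ _ => add_mem) (fun _ => neg_mem) (zero_mem _)
  rw [AddSubgroup.mem_comap, chainAct_single]
  change affineAct R X G (univGen R f r) ∈ smallChains R U m
  have := ConcreteCategory.congr_hom (univGen_affineAct R f G) r
  refine (congrArg (· ∈ smallChains R U m) this).mpr ?_
  exact univGen_mem_smallChains R (f := f.comp G.toMap) (fun t => hi _) r

/-- The metric is the supremum over coordinates. A coordinate has oscillation at most `1` on the
vertices, and its difference at two image points is the mean of its differences at image vertices,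
with weights `s i * t k`. -/
lemma toMap_dist_le {n m : ℕ} {G : AffineMatrix n m} {c : ℝ} (hG : Contracts G c) (hc : 0 ≤ c)
    (s t : Simplex m) : dist (G.toMap s) (G.toMap t) ≤ c := by
  rw [Subtype.dist_eq, dist_pi_le_iff hc]
  have key : ∀ (s t : Simplex m) j, (G.toMap s).1 j - (G.toMap t).1 j ≤ c := by
    intro s t j
    have h := hG (Pi.single j 1) 1 (fun i k => by
      rw [Pi.single_apply, Pi.single_apply]; split_ifs <;> norm_num)
    simp only [Matrix.mulVec_single_one, Matrix.col_apply, mul_one] at h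
    have h1 : (G.toMap s).1 j - (G.toMap t).1 j =
        ∑ i, ∑ k, s.1 i * t.1 k * (G.mat i j - G.mat k j) := by
      simp only [mul_sub, Finset.sum_sub_distrib]
      congr 1
      · simp only [mul_right_comm, ← Finset.mul_sum, t.2.2, mul_one]
        rfl
      · rw [Finset.sum_comm]
        simp only [mul_assoc, ← Finset.sum_mul, s.2.2, one_mul]
        rfl
    have h2 : c = ∑ i, ∑ k, s.1 i * t.1 k * c := by
      simp only [← Finset.sum_mul, ← Finset.mul_sum, t.2.2, mul_one, s.2.2, one_mul]
    rw [h1, h2]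
    exact Finset.sum_le_sum fun i _ => Finset.sum_le_sum fun k _ =>
      mul_le_mul_of_nonneg_left (h i k) (mul_nonneg (s.2.1 i) (t.2.1 k))
  intro j
  rw [Real.dist_eq, abs_le]
  exact ⟨by have := key t s j; linarith, key s t j⟩

/-- Here `ε` is a Lebesgue number for the preimages of the interiors under `f`. An affine map
contracting by less than `ε` has its image in a ball inside one of them. -/
lemma exists_contracting_small (hU : ⋃ i, interior (U i) = Set.univ) {n : ℕ}
    (f : C(Simplex n, X)) : ∃ ε > 0, ∀ c, 0 ≤ c → c < ε → ∀ x ∈ contracting n n c, ∀ r,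
      chainAct R X n n x (univGen R f r) ∈ smallChains R U n := by
  have : CompactSpace (Simplex n) := isCompact_iff_compactSpace.1 (isCompact_stdSimplex ℝ _)
  obtain ⟨ε, hε, h⟩ := lebesgue_number_lemma_of_metric (s := (Set.univ : Set (Simplex n)))
    (c := fun i => f ⁻¹' interior (U i)) isCompact_univ
    (fun i => isOpen_interior.preimage f.continuous)
    (by rw [← Set.preimage_iUnion, hU, Set.preimage_univ])
  refine ⟨ε, hε, fun c hc hcε x hx r => ?_⟩
  suffices contracting n n c ≤ (homsInto R (univGen R f r) (smallChains R U n)).comap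
    (chainAct R X n n) from this hx
  refine contracting_le fun G hG => ?_
  rw [AddSubgroup.mem_comap, chainAct_single]
  change affineAct R X G (univGen R f r) ∈ smallChains R U n
  refine (congrArg (· ∈ smallChains R U n)
    (ConcreteCategory.congr_hom (univGen_affineAct R f G) r)).mpr ?_
  obtain ⟨i, hi⟩ := h (G.toMap (stdSimplex.vertex 0)) (Set.mem_univ _)
  refine univGen_mem_smallChains R (f := f.comp G.toMap) (i := i)
    (fun t => interior_subset (hi ?_)) r
  exact (toMap_dist_le hG hc _ _).trans_lt hcε

/-- The iterated barycentric subdivision. -/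
def iteratedSubdivision (n : ℕ) : ℕ → (chainOf n ⟶ chainOf n)
  | 0 => 𝟙 _
  | k + 1 => iteratedSubdivision n k ≫ subdivision n

lemma iteratedSubdivision_mem_contracting (n k : ℕ) :
    iteratedSubdivision n k ∈ contracting n n (((n : ℝ) / (n + 1)) ^ k) := by
  induction k with
  | zero => exact single_mem_contracting (by rw [pow_zero]; exact contracts_id n)
  | succ k ih =>
    rw [pow_succ']
    exact comp_mem_contracting ih (subdivision_mem_contracting n)

/-- Every singular chain becomes small after sufficiently many subdivisions. -/
lemma exists_iteratedSubdivision_small (hU : ⋃ i, interior (U i) = Set.univ) {n : ℕ}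
    (a : chainsOf R X n) :
    ∃ k, ∀ l ≥ k, chainAct R X n n (iteratedSubdivision n l) a ∈ smallChains R U n := by
  -- Asking for smallness for all `l ≥ k` makes the condition stable under sums, so it suffices to
  -- check generators, whose `k` depends on `f`.
  let N : Submodule R (chainsOf R X n) :=
    { carrier := {a | ∃ k, ∀ l ≥ k,
        chainAct R X n n (iteratedSubdivision n l) a ∈ smallChains R U n}
      add_mem' := by
        rintro a b ⟨k, hk⟩ ⟨k', hk'⟩
        refine ⟨max k k', fun l hl => ?_⟩
        rw [map_add]
        exact add_mem (hk l (le_of_max_le_left hl)) (hk' l (le_of_max_le_right hl))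
      zero_mem' := ⟨0, fun l _ => by rw [map_zero]; exact zero_mem _⟩
      smul_mem' := by
        rintro r a ⟨k, hk⟩
        refine ⟨k, fun l hl => ?_⟩
        rw [map_smul]
        exact Submodule.smul_mem _ _ (hk l hl) }
  suffices N = ⊤ from (this ▸ Submodule.mem_top : a ∈ N)
  refine singularGen_span R N fun f _ r => ?_
  obtain ⟨ε, hε, h⟩ := exists_contracting_small R U hU f
  have hlt : (n : ℝ) / (n + 1) < 1 := by
    rw [div_lt_one (by positivity)]
    linarith
  obtain ⟨k, hk⟩ := exists_pow_lt_of_lt_one hε hlt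
  refine ⟨k, fun l hl => h _ (by positivity) (lt_of_le_of_lt ?_ hk) _
    (iteratedSubdivision_mem_contracting n l) r⟩
  exact pow_le_pow_of_le_one (by positivity) hlt.le hl

lemma differential_mem_smallChains {n : ℕ} (j : ℕ) {a : chainsOf R X n}
    (ha : a ∈ smallChains R U n) :
    ((singularChains R X).differential n j).app Set.univ a ∈ smallChains R U j := by
  by_cases h : j + 1 = n
  · subst h
    rw [← chainAct_boundary]
    exact chainAct_mem_smallChains R U _ ha
  · rw [(singularChains R X).differential_shape n j h]
    exact zero_mem _

/-- By the homotopy formula `a - S a - d(T a) = T(d a)`, which is small because `d a` is. In degree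
`0` the subdivision is the identity. -/
lemma sub_subdivision_mem {n : ℕ} (a : chainsOf R X n)
    (ha : ∀ j, ((singularChains R X).differential n j).app Set.univ a ∈ smallChains R U j) :
    ∃ w : chainsOf R X (n + 1), a - chainAct R X n n (subdivision n) a -
      ((singularChains R X).differential (n + 1) n).app Set.univ w ∈ smallChains R U n := by
  obtain _ | n := n
  · refine ⟨0, ?_⟩
    rw [subdivision, chainAct_id, map_zero, sub_zero]
    change a - a ∈ _
    rw [sub_self]
    exact zero_mem _
  · refine ⟨chainAct R X _ _ (subdivisionHomotopy (n + 1)) a, ?_⟩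
    have h := chainAct_mem_smallChains R U (subdivisionHomotopy n) (ha n)
    convert h using 1
    have h1 := congrArg (chainAct R X _ _) (subdivision_succ n)
    rw [map_sub, map_sub, chainAct_id, chainAct_comp, chainAct_comp, chainAct_boundary,
      chainAct_boundary] at h1
    have h2 : chainAct R X _ _ (subdivision (n + 1)) a = a -
      ((singularChains R X).differential (n + 1 + 1) (n + 1)).app Set.univ
        (chainAct R X _ _ (subdivisionHomotopy (n + 1)) a) -
      chainAct R X _ _ (subdivisionHomotopy n)
        (((singularChains R X).differential (n + 1) n).app Set.univ a) :=
      ConcreteCategory.congr_hom h1 a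
    rw [h2]
    abel

/-- A singular chain with small boundary is small up to a boundary. -/
theorem exists_sub_boundary_small (hU : ⋃ i, interior (U i) = Set.univ) {n : ℕ}
    (a : chainsOf R X n)
    (ha : ∀ j, ((singularChains R X).differential n j).app Set.univ a ∈ smallChains R U j) :
    ∃ w : chainsOf R X (n + 1),
      a - ((singularChains R X).differential (n + 1) n).app Set.univ w ∈ smallChains R U n := by
  have key : ∀ k, ∃ w : chainsOf R X (n + 1),
      a - chainAct R X n n (iteratedSubdivision n k) a -
        ((singularChains R X).differential (n + 1) n).app Set.univ w ∈ smallChains R U n := by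
    intro k
    induction k with
    | zero =>
      refine ⟨0, ?_⟩
      rw [iteratedSubdivision, chainAct_id, map_zero, sub_zero]
      change a - a ∈ _
      rw [sub_self]
      exact zero_mem _
    | succ k ih =>
      obtain ⟨w, hw⟩ := ih
      -- The `k`-fold subdivision of `a` also has small boundary: it differs from `a` by a boundary
      -- and a small chain.
      obtain ⟨w', hw'⟩ := sub_subdivision_mem R U
        (chainAct R X n n (iteratedSubdivision n k) a) (fun j => by
          have h1 := differential_mem_smallChains R U j hw
          have h2 : ((singularChains R X).differential n j).app Set.univ
              (((singularChains R X).differential (n + 1) n).app Set.univ w) = 0 :=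
            d_comp_d_apply ((singularChains R X).chains.obj Set.univ) _ _ _ w
          rw [map_sub, map_sub, h2, sub_zero] at h1
          have h3 := sub_mem (ha j) h1
          rwa [sub_sub_cancel] at h3)
      refine ⟨w + w', ?_⟩
      have h1 := add_mem hw hw'
      have h2 : chainAct R X n n (iteratedSubdivision n (k + 1)) a =
          chainAct R X n n (subdivision n) (chainAct R X n n (iteratedSubdivision n k) a) :=
        ConcreteCategory.congr_hom
          (chainAct_comp R (iteratedSubdivision n k) (subdivision n)) a
      rw [h2, map_add]
      convert h1 using 1
      abel
  obtain ⟨k, hk⟩ := exists_iteratedSubdivision_small R U hU a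
  obtain ⟨w, hw⟩ := key k
  refine ⟨w, ?_⟩
  have := add_mem hw (hk k le_rfl)
  convert this using 1
  abel

end Small

/-! ### The morphism `τ` for singular chains -/

section Tau

lemma ιTotal_tau {R : Type u} [Ring R] {X ι : Type u} [LinearOrder ι] (U : ι → Set X)
    (e : AugmentedChainFunctor R X) (n : ℕ) :
    (doubleComplex e U).ιTotal (ComplexShape.down ℕ) n 0 n rfl ≫ (tau e U).f n =
      nerveAugmentation U (e.component n) :=
  (HomologicalComplex₂.ι_totalDesc _ _ _ _ _).trans (Category.comp_id _)

lemma ιTotal_tau_succ {R : Type u} [Ring R] {X ι : Type u} [LinearOrder ι] (U : ι → Set X)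
    (e : AugmentedChainFunctor R X) (q p n : ℕ)
    (h : (ComplexShape.down ℕ).π (ComplexShape.down ℕ) (ComplexShape.down ℕ) (q, p + 1) = n) :
    (doubleComplex e U).ιTotal (ComplexShape.down ℕ) q (p + 1) n h ≫ (tau e U).f n = 0 :=
  HomologicalComplex₂.ι_totalDesc _ _ _ _ _

variable (R : Type u) [Ring R] {X : Type u} [TopologicalSpace X] {ι : Type u} [LinearOrder ι]
  (U : ι → Set X)

lemma nerveAugmentation_mem_smallChains (n : ℕ)
    (x : nerveChainsX U ((singularChains R X).component n) 0) :
    nerveAugmentation U ((singularChains R X).component n) x ∈ smallChains R U n := by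
  obtain ⟨Q, hQ⟩ : ∃ Q : chainsOf R X n ⟶ ModuleCat.of R (chainsOf R X n ⧸ smallChains R U n),
      ∀ a, Q a = 0 ↔ a ∈ smallChains R U n :=
    ⟨ModuleCat.ofHom (smallChains R U n).mkQ, fun a => Submodule.Quotient.mk_eq_zero _⟩
  have : nerveAugmentation U ((singularChains R X).component n) ≫ Q = 0 := by
    apply nerveGen_hom_ext
    intro σ f h
    rw [← Category.assoc, nerveGen_augmentation R U n h, comp_zero]
    ext
    obtain ⟨i, hi⟩ := Finset.card_pos.1 (show 0 < σ.card by rw [h.card_eq]; omega)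
    exact (hQ _).2 (univGen_mem_smallChains R (h.mem_of_mem U hi) _)
  exact (hQ _).1 (ConcreteCategory.congr_hom this x)

/-- A simplex lying in `U i` comes from the vertex `{i}` of the nerve. Together with
`tau_mem_smallChains` this identifies the image of `τ` with the small chains. -/
lemma exists_nerveAugmentation_eq (n : ℕ) {a : chainsOf R X n} (ha : a ∈ smallChains R U n) :
    ∃ x, nerveAugmentation U ((singularChains R X).component n) x = a := by
  suffices smallChains R U n ≤
    LinearMap.range (nerveAugmentation U ((singularChains R X).component n)).hom from this ha
  refine Submodule.span_le.2 ?_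
  rintro _ ⟨f, ⟨i, hi⟩, r, rfl⟩
  have hc : Carries U 0 {i} f := ⟨Finset.card_singleton i, fun t => by
    simpa [support] using hi t⟩
  exact ⟨nerveGen R U n 0 {i} f r,
    ConcreteCategory.congr_hom (nerveGen_augmentation R U n hc) r⟩

lemma tau_mem_smallChains (n : ℕ) (t : (totalComplex (singularChains R X) U).X n) :
    (tau (singularChains R X) U).f n t ∈ smallChains R U n := by
  have := total_span (doubleComplex (singularChains R X) U) n
    ((smallChains R U n).comap ((tau (singularChains R X) U).f n).hom) (fun q p h x => by
      obtain _ | p := p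
      · obtain rfl : q = n := by dsimp at h; omega
        have h1 := ConcreteCategory.congr_hom (ιTotal_tau U (singularChains R X) q) x
        exact (congrArg (· ∈ smallChains R U q) h1).mpr
          (nerveAugmentation_mem_smallChains R U q x)
      · have h1 := ConcreteCategory.congr_hom (ιTotal_tau_succ U (singularChains R X) q p n h) x
        exact (congrArg (· ∈ smallChains R U n) h1).mpr (zero_mem _))
  exact (this ▸ Submodule.mem_top : t ∈ (smallChains R U n).comap
    ((tau (singularChains R X) U).f n).hom)

/-- If the interiors of the members of `U` cover `X`, then `τ` induces isomorphisms in homology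
for singular chains. -/
theorem isIso_homologyMap_tau (hU : ⋃ i, interior (U i) = Set.univ) (n : ℕ) :
    IsIso (HomologicalComplex.homologyMap (tau (singularChains R X) U) n) := by
  refine isIso_homologyMap_total_inner (doubleComplex (singularChains R X) U)
    (tau (singularChains R X) U) ?_ ?_ ?_ ?_ n
  · exact ιTotal_tau_succ U _
  · intro n x hx
    obtain ⟨y, hy⟩ := nerveAugmentation_exact R U n x
      ((ConcreteCategory.congr_hom (ιTotal_tau U (singularChains R X) n) x).symm.trans hx)
    refine ⟨y, ?_⟩
    rw [← hy]
    exact ConcreteCategory.congr_hom (nerveChains_d U ((singularChains R X).component n) 0) y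
  · intro q p x hx
    obtain ⟨y, hy⟩ := nerveBoundary_exact R U q p x
      ((ConcreteCategory.congr_hom
        (nerveChains_d U ((singularChains R X).component q) p) x).symm.trans hx)
    refine ⟨y, ?_⟩
    rw [← hy]
    exact ConcreteCategory.congr_hom
      (nerveChains_d U ((singularChains R X).component q) (p + 1)) y
  · intro n a ha
    -- A boundary in the image of `τ` is small, so `a` is small up to a boundary and lifts to
    -- vertices of the nerve.
    obtain ⟨w, hw⟩ := exists_sub_boundary_small R U hU a (fun j => by
      obtain ⟨t, ht⟩ := ha j
      exact (congrArg (· ∈ smallChains R U j) ht).mpr (tau_mem_smallChains R U j t))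
    obtain ⟨x, hx⟩ := exists_nerveAugmentation_eq R U n hw
    refine ⟨(doubleComplex (singularChains R X) U).ιTotal (ComplexShape.down ℕ) n 0 n rfl x, w, ?_⟩
    have h1 := (ConcreteCategory.congr_hom (ιTotal_tau U (singularChains R X) n) x).trans hx
    refine Eq.trans ?_ (congrArg (((singularChains R X).chains.obj Set.univ).d (n + 1) n w + ·)
      h1.symm)
    exact (add_sub_cancel _ _).symm

end Tau

end HomologicalLeray

end

/-! ### Factorization of `φ_*` through the homology of the nerve -/

theorem mainTheorem3 {R : Type u} [Ring R] {X : Type u} [TopologicalSpace X]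
    {ι : Type u} [LinearOrder ι] (U : ι → Set X)
    (hU : ⋃ i, interior (U i) = Set.univ)
    (e : HomologicalLeray.AugmentedChainFunctor R X)
    (φ : (HomologicalLeray.singularChains R X).Hom e)
    (he : e.IsAcyclicCover U) :
    ∃ _ : ∀ n : ℕ, IsIso (HomologicalComplex.homologyMap
        (HomologicalLeray.tau (HomologicalLeray.singularChains R X) U) n),
      ∀ n : ℕ, ∃ g : (HomologicalLeray.simplicialChains R U).homology n ⟶ e.homology Set.univ n,
        HomologicalLeray.canonicalMap R U n ≫ g = φ.homologyMap Set.univ n := by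
  have hτ := HomologicalLeray.isIso_homologyMap_tau R U hU
  refine ⟨hτ, fun n => ?_⟩
  have hl := HomologicalLeray.isIso_homologyMap_lambda U e he n
  refine ⟨inv (HomologicalComplex.homologyMap (HomologicalLeray.lambda e U) n) ≫
    HomologicalComplex.homologyMap (HomologicalLeray.tau e U) n, ?_⟩
  -- After cancelling `τ_{C*}`, replacing `λ_C` by `λ_e ∘ t(φ)` cancels `λ_{e*}` against its
  -- inverse, and naturality of `τ` finishes.
  rw [HomologicalLeray.canonicalMap, Category.assoc, IsIso.inv_comp_eq,
    ← HomologicalLeray.totalComplexMap_lambda U φ, HomologicalComplex.homologyMap_comp,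
    Category.assoc, IsIso.hom_inv_id_assoc, ← HomologicalComplex.homologyMap_comp,
    HomologicalLeray.totalComplexMap_tau, HomologicalComplex.homologyMap_comp]
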